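/- Consider the plane divided into the zones $R_L=\{x<-1\}$, $R_C=\{-1<x<1\}$, $R_R=\{x>1\}$ and, for $\epsilon\ge 0$, the discontinuous piecewise linear system $$\dot x = H_y(x,y)+\epsilon f(x,y),\qquad \dot y=-H_x(x,y)+\epsilon g(x,y),$$ where in the zone $R_i$, $i\in\{L,C,R\}$, $H=H^i$, $f=p_ix+q_iy+r_i$, $g=s_ix+u_iy+v_i$ with real constants $p_i,q_i,r_i,s_i,u_i,v_i$, and $$H^L=\tfrac{b_L}{2}y^2-\tfrac{c_L}{2}x^2+a_Lxy+a_Ly-\beta_Lx,\quad H^C=\tfrac12x^2+\tfrac12y^2,\quad H^R=\tfrac{b_R}{2}y^2-\tfrac{c_R}{2}x^2+a_Rxy-a_Ry-\beta_Rx.$$ A (crossing) solution follows the vector field of the zone it is in and meets the lines $x=\pm1$ only at points where the $\dot x$-components of the two adjacent fields have the same nonzero sign, passing there from one zone to the other; a periodic orbit is the image of a nonconstant periodic solution; a limit cycle is a periodic orbit that has a neighbourhood containing no other periodic orbit. For $h>0$ let $L_h$ be the closed curve through $(1,h),(1,-h),(-1,-h),(-1,h)$ formed by the arcs $\{H^R=H^R(1,h),\,x>1\}$,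 $\{H^C=H^C(1,-h),\,-1\le x\le 1,\,y<0\}$, $\{H^L=H^L(-1,-h),\,x<-1\}$, $\{H^C=H^C(-1,h),\,-1\le x\le1,\,y>0\}$. Let $a_L=b_R=\beta_L=1$, $b_L=2$, $c_L=c_R=-1$, $a_R=\beta_R=0$. Then the left, central and right subsystems for $\epsilon=0$ have centers (equilibria whose linear part has eigenvalues $\pm i\omega$, $\omega>0$), the central one in $R_C$ (real) and the outer ones not in $R_L$, respectively $R_R$ (virtual); for $\epsilon=0$ every $L_h$, $h>0$, is a periodic orbit, so that these curves form a periodic annulus; and at least three limit cycles can bifurcate from this annulus: there are perturbation constants $p_i,q_i,r_i,s_i,u_i,v_i$ ($i=L,C,R$), numbers $0<h_1<h_2<h_3$ and $\epsilon_0>0$ such that for every $0<\epsilon<\epsilon_0$ the system has three distinct limit cycles $\Gamma_1(\epsilon),\Gamma_2(\epsilon),\Gamma_3(\epsilon)$, each visiting the three zones, and $\Gamma_j(\epsilon)\to L_{h_j}$ in the Hausdorff distance as $\epsilon\to0^+$, $j=1,2,3$. -/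

import Mathlib

open Set Filter Topology

namespace ThreeZone

/-- The three zones of the plane cut out by the switching lines `x = -1` and `x = 1`:
left, central and right. -/
inductive Zone where
  | L
  | C
  | R

/-- The open zones `x < -1`, `-1 < x < 1` and `1 < x`. -/
def Zone.region : Zone → Set (ℝ × ℝ)
  | .L => {P | P.1 < -1}
  | .C => {P | -1 < P.1 ∧ P.1 < 1}
  | .R => {P | 1 < P.1}

/-- Coefficients of a quadratic Hamiltonian. -/
structure HamCoeffs where
  a : ℝ
  b : ℝ
  c : ℝ
  α : ℝ
  β : ℝ

/-- Coefficients of an affine perturbation `(f, g)`. -/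
structure PertCoeffs where
  p : ℝ
  q : ℝ
  r : ℝ
  s : ℝ
  u : ℝ
  v : ℝ

/-- `H(x,y) = (b/2) y² - (c/2) x² + a x y + α y - β x`. -/
noncomputable def HamCoeffs.H (k : HamCoeffs) (x y : ℝ) : ℝ :=
  k.b / 2 * y ^ 2 - k.c / 2 * x ^ 2 + k.a * x * y + k.α * y - k.β * x

/-- `f(x,y) = p x + q y + r`. -/
def PertCoeffs.f (w : PertCoeffs) (x y : ℝ) : ℝ := w.p * x + w.q * y + w.r

/-- `g(x,y) = s x + u y + v`. -/
def PertCoeffs.g (w : PertCoeffs) (x y : ℝ) : ℝ := w.s * x + w.u * y + w.v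

/-- The near-Hamiltonian vector field `(H_y + ε f, -H_x + ε g)`. -/
noncomputable def field (k : HamCoeffs) (w : PertCoeffs) (ε : ℝ) (P : ℝ × ℝ) : ℝ × ℝ :=
  (deriv (fun y => k.H P.1 y) P.2 + ε * w.f P.1 P.2,
    -deriv (fun x => k.H x P.2) P.1 + ε * w.g P.1 P.2)

/-- The near-Hamiltonian vector field in closed form. -/
theorem field_eq (k : HamCoeffs) (w : PertCoeffs) (ε : ℝ) (P : ℝ × ℝ) :
    field k w ε P =
      (k.b * P.2 + k.a * P.1 + k.α + ε * (w.p * P.1 + w.q * P.2 + w.r),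
        k.c * P.1 - k.a * P.2 + k.β + ε * (w.s * P.1 + w.u * P.2 + w.v)) := by
  have h1 : HasDerivAt (fun y => k.H P.1 y) (k.b * P.2 + k.a * P.1 + k.α) P.2 := by
    have h := (((((hasDerivAt_pow 2 P.2).const_mul (k.b / 2)).sub_const
      (k.c / 2 * P.1 ^ 2)).add ((hasDerivAt_id' P.2).const_mul (k.a * P.1))).add
      ((hasDerivAt_id' P.2).const_mul k.α)).sub_const (k.β * P.1)
    exact h.congr_deriv (by norm_num; ring)
  have h2 : HasDerivAt (fun x => k.H x P.2) (-(k.c * P.1 - k.a * P.2 + k.β)) P.1 := by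
    have h := ((((((hasDerivAt_pow 2 P.1).const_mul (k.c / 2)).const_sub
      (k.b / 2 * P.2 ^ 2)).add (((hasDerivAt_id' P.1).const_mul k.a).mul_const P.2)).add_const
      (k.α * P.2)).sub ((hasDerivAt_id' P.1).const_mul k.β))
    exact h.congr_deriv (by norm_num; ring)
  simp only [field, h1.deriv, h2.deriv, PertCoeffs.f, PertCoeffs.g, neg_neg]

/-- The piecewise near-Hamiltonian system: one vector field for each zone. -/
noncomputable def system (k : Zone → HamCoeffs) (w : Zone → PertCoeffs) (ε : ℝ) :
    Zone → ℝ × ℝ → ℝ × ℝ :=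
  fun z => field (k z) (w z) ε

/-- At time `t` the curve `γ` is at a crossing point of a vertical switching line and passes
through it: `X` is the field on the left of the line and `Y` the one on the right.  Their
components normal to the line have the same sign there; the curve arrives along the field of the
side it comes from and leaves along the field of the side it enters. -/
def CrossesAt (X Y : ℝ × ℝ → ℝ × ℝ) (γ : ℝ → ℝ × ℝ) (t : ℝ) : Prop :=
  0 < (X (γ t)).1 * (Y (γ t)).1 ∧
  (0 < (X (γ t)).1 →
    HasDerivWithinAt γ (X (γ t)) (Iic t) t ∧ HasDerivWithinAt γ (Y (γ t)) (Ici t) t) ∧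
  ((X (γ t)).1 < 0 →
    HasDerivWithinAt γ (Y (γ t)) (Iic t) t ∧ HasDerivWithinAt γ (X (γ t)) (Ici t) t)

/-- `γ` is a (crossing) solution, defined for all times, of the piecewise smooth system `X`:
it follows the field of the zone it is in, and it meets the switching lines `x = -1` and `x = 1`
only at crossing points. -/
def IsCrossingSolution (X : Zone → ℝ × ℝ → ℝ × ℝ) (γ : ℝ → ℝ × ℝ) : Prop :=
  ∀ t : ℝ,
    (∀ z : Zone, γ t ∈ z.region → HasDerivAt γ (X z (γ t)) t) ∧
    ((γ t).1 = -1 → CrossesAt (X .L) (X .C) γ t) ∧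
    ((γ t).1 = 1 → CrossesAt (X .C) (X .R) γ t)

/-- `Γ` is the orbit of a nonconstant periodic solution of the piecewise system `X`. -/
def IsPeriodicOrbit (X : Zone → ℝ × ℝ → ℝ × ℝ) (Γ : Set (ℝ × ℝ)) : Prop :=
  ∃ (γ : ℝ → ℝ × ℝ) (T : ℝ), IsCrossingSolution X γ ∧ 0 < T ∧ Function.Periodic γ T ∧
    (∃ t, γ t ≠ γ 0) ∧ Γ = range γ

/-- A limit cycle: a periodic orbit with a neighbourhood that contains no other periodic orbit. -/
def IsLimitCycle (X : Zone → ℝ × ℝ → ℝ × ℝ) (Γ : Set (ℝ × ℝ)) : Prop :=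
  IsPeriodicOrbit X Γ ∧
    ∃ U : Set (ℝ × ℝ), IsOpen U ∧ Γ ⊆ U ∧ ∀ Γ', IsPeriodicOrbit X Γ' → Γ' ⊆ U → Γ' = Γ

/-- The matrix of the linear part of the Hamiltonian vector field of `k`. -/
def HamCoeffs.linearPart (k : HamCoeffs) : Matrix (Fin 2) (Fin 2) ℝ :=
  !![k.a, k.b; k.c, -k.a]

/-- `P` is an equilibrium of the Hamiltonian vector field of `k` and it is a center: the
eigenvalues of the linear part are `± i ω` with `ω > 0`. -/
def HamCoeffs.IsCenterAt (k : HamCoeffs) (P : ℝ × ℝ) : Prop :=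
  deriv (fun y => k.H P.1 y) P.2 = 0 ∧ deriv (fun x => k.H x P.2) P.1 = 0 ∧
    ∃ ω : ℝ, 0 < ω ∧
      k.linearPart.charpoly = Polynomial.X ^ 2 + Polynomial.C (ω ^ 2)

/-- The Hamiltonians in normal form: `α_L = a_L`, `α_R = -a_R` and `H^C = (x² + y²) / 2`. -/
def normalForm (aL bL cL βL aR bR cR βR : ℝ) : Zone → HamCoeffs
  | .L => { a := aL, b := bL, c := cL, α := aL, β := βL }
  | .C => { a := 0, b := 1, c := -1, α := 0, β := 0 }
  | .R => { a := aR, b := bR, c := cR, α := -aR, β := βR }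

/-- The closed curve `L_h` through `(1,h)`, `(1,-h)`, `(-1,-h)`, `(-1,h)` that is made of four arcs
of level curves of the Hamiltonians. -/
def annulusOrbit (k : Zone → HamCoeffs) (h : ℝ) : Set (ℝ × ℝ) :=
  {P | (k .R).H P.1 P.2 = (k .R).H 1 h ∧ 1 < P.1} ∪
  {P | (k .C).H P.1 P.2 = (k .C).H 1 (-h) ∧ -1 ≤ P.1 ∧ P.1 ≤ 1 ∧ P.2 < 0} ∪
  {P | (k .L).H P.1 P.2 = (k .L).H (-1) (-h) ∧ P.1 < -1} ∪
  {P | (k .C).H P.1 P.2 = (k .C).H (-1) h ∧ -1 ≤ P.1 ∧ P.1 ≤ 1 ∧ 0 < P.2}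

/-- The parameters of the case of three centers, the two outer ones virtual. -/
def virtualCenters : Zone → HamCoeffs :=
  normalForm (aL := 1) (bL := 2) (cL := -1) (βL := 1) (aR := 0) (bR := 1) (cR := -1) (βR := 0)

end ThreeZone

/-!
In each zone the perturbed field, for `ε > 0`, is a linear focus that can be integrated in closed
form. The perturbation is the same in the central and in the right zone, namely the radial field
`ε b (x, y)`, so that these two zones act as one zone `x > -1`; in the left zone it is the radial
field `ε a (P - P₀)` about the virtual center `P₀ = (3, -2)` together with a constant drift of
size `ε κ`. A periodic orbit that visits both sides of `x = -1` is then described by the heights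
`y₀` and `-y₁` of its crossings, and the two half returns give two explicit equations, `RightRel`
and `LeftRel`.

In terms of the mean of `y₀`, `y₁` and of their half difference divided by `ε` these equations
extend smoothly to `ε = 0`, where they reduce to the vanishing of the Melnikov function
`2 κ m + 2 b (1 + m²) (π - arctan m) + 2 a (4 + m²) arctan (m / 2)`. By the implicit function
theorem every simple zero `h` of it continues to a locally unique solution for small `ε`
(`exists_branch`). For `b = 1`, `a = -21/20` the zeros are the solutions of `drift m = κ`, and
`drift` is low, high, low, high at `1/10`, `2`, `6`, `100`; a regular value `κ` in the gap, which
exists by Sard's theorem, gives three simple zeros (`exists_three_simple_zeros`).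

A solution of the equations yields a periodic orbit by closing up two spiral arcs
(`isPeriodicOrbit_cycle`); the case `ε = 0` is the unperturbed annulus (`cycle_zero_eq`).
For the isolation (`isLimitCycle_cycle`), a periodic orbit near the cycle crosses `x = -1` only
near the two crossing points. Both half return maps are increasing, so the highest and the lowest of
its rising crossings are fixed points of the return map; by local uniqueness they coincide with
the crossing of the cycle, and so do the orbits.
-/

namespace ThreeZone

/-! ### Linear spirals -/

/-- First coordinate of the solution of `u' = c u + v`, `v' = c v - u` that starts at
`(u₀, v₀)`. -/
noncomputable def spiralU (c u₀ v₀ t : ℝ) : ℝ :=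
  Real.exp (c * t) * (u₀ * Real.cos t + v₀ * Real.sin t)

/-- Second coordinate of the solution of `u' = c u + v`, `v' = c v - u` that starts at
`(u₀, v₀)`. -/
noncomputable def spiralV (c u₀ v₀ t : ℝ) : ℝ :=
  Real.exp (c * t) * (v₀ * Real.cos t - u₀ * Real.sin t)

@[simp] theorem spiralU_zero (c u₀ v₀ : ℝ) : spiralU c u₀ v₀ 0 = u₀ := by simp [spiralU]

@[simp] theorem spiralV_zero (c u₀ v₀ : ℝ) : spiralV c u₀ v₀ 0 = v₀ := by simp [spiralV]

theorem hasDerivAt_spiralU (c u₀ v₀ t : ℝ) :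
    HasDerivAt (spiralU c u₀ v₀) (c * spiralU c u₀ v₀ t + spiralV c u₀ v₀ t) t := by
  have h1 : HasDerivAt (fun t => Real.exp (c * t)) (Real.exp (c * t) * c) t := by
    simpa using ((hasDerivAt_id t).const_mul c).exp
  have h2 := ((Real.hasDerivAt_cos t).const_mul u₀).add ((Real.hasDerivAt_sin t).const_mul v₀)
  exact (h1.mul h2).congr_deriv (by simp only [spiralU, spiralV, Pi.add_apply]; ring)

theorem hasDerivAt_spiralV (c u₀ v₀ t : ℝ) :
    HasDerivAt (spiralV c u₀ v₀) (c * spiralV c u₀ v₀ t - spiralU c u₀ v₀ t) t := by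
  have h1 : HasDerivAt (fun t => Real.exp (c * t)) (Real.exp (c * t) * c) t := by
    simpa using ((hasDerivAt_id t).const_mul c).exp
  have h2 := ((Real.hasDerivAt_cos t).const_mul v₀).sub ((Real.hasDerivAt_sin t).const_mul u₀)
  exact (h1.mul h2).congr_deriv (by simp only [spiralU, spiralV, Pi.sub_apply]; ring)

theorem spiral_sq (c u₀ v₀ t : ℝ) :
    spiralV c u₀ v₀ t ^ 2 + spiralU c u₀ v₀ t ^ 2 = Real.exp (2 * c * t) * (v₀ ^ 2 + u₀ ^ 2) := by
  have h : Real.exp (2 * c * t) = Real.exp (c * t) ^ 2 := by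
    rw [← Real.exp_nat_mul]; congr 1; push_cast; ring
  rw [h, spiralU, spiralV]
  linear_combination (Real.exp (c * t) ^ 2 * (u₀ ^ 2 + v₀ ^ 2)) * Real.sin_sq_add_cos_sq t

/-- Uniqueness of solutions for the spiral equation: the squared distance to the explicit solution,
rescaled by `exp (-2 c t)`, is constant. -/
theorem eq_spiral {c t₁ t₂ : ℝ} {u v : ℝ → ℝ}
    (hu : ContinuousOn u (Icc t₁ t₂)) (hv : ContinuousOn v (Icc t₁ t₂))
    (hu' : ∀ t ∈ Ioo t₁ t₂, HasDerivAt u (c * u t + v t) t)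
    (hv' : ∀ t ∈ Ioo t₁ t₂, HasDerivAt v (c * v t - u t) t) {t : ℝ} (ht : t ∈ Icc t₁ t₂) :
    u t = spiralU c (u t₁) (v t₁) (t - t₁) ∧ v t = spiralV c (u t₁) (v t₁) (t - t₁) := by
  set U : ℝ → ℝ := fun s => spiralU c (u t₁) (v t₁) (s - t₁) with hU
  set V : ℝ → ℝ := fun s => spiralV c (u t₁) (v t₁) (s - t₁) with hV
  have hUd : ∀ s, HasDerivAt U (c * U s + V s) s := fun s =>
    (hasDerivAt_spiralU c (u t₁) (v t₁) (s - t₁)).comp_sub_const s t₁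
  have hVd : ∀ s, HasDerivAt V (c * V s - U s) s := fun s =>
    (hasDerivAt_spiralV c (u t₁) (v t₁) (s - t₁)).comp_sub_const s t₁
  set g : ℝ → ℝ := fun s => Real.exp (-(2 * c) * s) * ((u s - U s) ^ 2 + (v s - V s) ^ 2) with hg
  have hgc : ContinuousOn g (Icc t₁ t₂) := by
    have hUc : Continuous U := continuous_iff_continuousAt.2 fun s => (hUd s).continuousAt
    have hVc : Continuous V := continuous_iff_continuousAt.2 fun s => (hVd s).continuousAt
    have he : Continuous fun s : ℝ => Real.exp (-(2 * c) * s) := by fun_prop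
    exact he.continuousOn.mul
      (((hu.sub hUc.continuousOn).pow 2).add ((hv.sub hVc.continuousOn).pow 2))
  have hgd : ∀ s ∈ Ioo t₁ t₂, HasDerivAt g 0 s := by
    intro s hs
    have h1 : HasDerivAt (fun s => Real.exp (-(2 * c) * s))
        (Real.exp (-(2 * c) * s) * -(2 * c)) s := by
      simpa using ((hasDerivAt_id s).const_mul (-(2 * c))).exp
    have h2 := (((hu' s hs).sub (hUd s)).pow 2).add (((hv' s hs).sub (hVd s)).pow 2)
    exact (h1.mul h2).congr_deriv (by simp; ring)
  have hgt : g t = 0 := by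
    rcases eq_or_lt_of_le ht.1 with h | h
    · simp [hg, hU, hV, ← h]
    · obtain ⟨s, hs, hs'⟩ := exists_hasDerivAt_eq_slope g (fun _ => 0) h
        (hgc.mono (Icc_subset_Icc_right ht.2))
        (fun s hs => hgd s ⟨hs.1, hs.2.trans_le ht.2⟩)
      have h0 : g t₁ = 0 := by simp [hg, hU, hV]
      have h3 : t - t₁ ≠ 0 := by linarith
      field_simp at hs'
      linarith
  have hsum : (u t - U t) ^ 2 + (v t - V t) ^ 2 = 0 := by
    have := (mul_eq_zero.1 hgt).resolve_left (Real.exp_pos _).ne'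
    exact this
  constructor
  · nlinarith [sq_nonneg (u t - U t), sq_nonneg (v t - V t)]
  · nlinarith [sq_nonneg (u t - U t), sq_nonneg (v t - V t)]

/-- Polar form of a spiral that starts on the line `v = d`; the start has the polar angle
`arctan (u₀ / d)`, measured from the positive `v`-axis. -/
theorem spiral_polar {c d u₀ : ℝ} (hd : 0 < d) (t : ℝ) :
    spiralV c u₀ d t =
        Real.exp (c * t) * Real.sqrt (d ^ 2 + u₀ ^ 2) * Real.cos (t + Real.arctan (u₀ / d)) ∧
      spiralU c u₀ d t =
        Real.exp (c * t) * Real.sqrt (d ^ 2 + u₀ ^ 2) * Real.sin (t + Real.arctan (u₀ / d)) := by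
  have hs : Real.sqrt (1 + (u₀ / d) ^ 2) = Real.sqrt (d ^ 2 + u₀ ^ 2) / d := by
    rw [show 1 + (u₀ / d) ^ 2 = (d ^ 2 + u₀ ^ 2) / d ^ 2 by field_simp,
      Real.sqrt_div' _ (sq_nonneg d), Real.sqrt_sq hd.le]
  have hp : 0 < Real.sqrt (d ^ 2 + u₀ ^ 2) := Real.sqrt_pos.2 (by positivity)
  have hc : Real.cos (Real.arctan (u₀ / d)) = d / Real.sqrt (d ^ 2 + u₀ ^ 2) := by
    rw [Real.cos_arctan, hs]; field_simp
  have hsn : Real.sin (Real.arctan (u₀ / d)) = u₀ / Real.sqrt (d ^ 2 + u₀ ^ 2) := by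
    rw [Real.sin_arctan, hs]; field_simp
  rw [Real.cos_add, Real.sin_add, hc, hsn, spiralU, spiralV]
  constructor
  · field_simp
  · field_simp
    ring

/-- A spiral that starts at `(u₀, d)` reaches `(u₁, d)` when it has turned by the right angle and
the radii fit. -/
theorem spiral_end {c d u₀ u₁ τ : ℝ} (hd : 0 < d) (n : ℤ)
    (hτ : τ = Real.arctan (u₁ / d) - Real.arctan (u₀ / d) + n * (2 * Real.pi))
    (hr : d ^ 2 + u₁ ^ 2 = Real.exp (2 * c * τ) * (d ^ 2 + u₀ ^ 2)) :
    spiralV c u₀ d τ = d ∧ spiralU c u₀ d τ = u₁ := by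
  have h1 := spiral_polar (c := c) (u₀ := u₀) hd τ
  have h2 := spiral_polar (c := 0) (u₀ := u₁) hd 0
  have hs : Real.exp (c * τ) * Real.sqrt (d ^ 2 + u₀ ^ 2) = Real.sqrt (d ^ 2 + u₁ ^ 2) := by
    rw [hr, Real.sqrt_mul (Real.exp_pos _).le]
    congr 1
    rw [show 2 * c * τ = c * τ + c * τ by ring, Real.exp_add,
      Real.sqrt_mul_self (Real.exp_pos _).le]
  have ha : τ + Real.arctan (u₀ / d) = Real.arctan (u₁ / d) + n * (2 * Real.pi) := by
    rw [hτ]; ring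
  rw [ha, Real.cos_add_int_mul_two_pi, Real.sin_add_int_mul_two_pi, hs] at h1
  simp only [spiralV_zero, spiralU_zero, mul_zero, Real.exp_zero, one_mul, zero_add] at h2
  exact ⟨h1.1.trans h2.1.symm, h1.2.trans h2.2.symm⟩

theorem hasDerivAt_exp_mul_cos (c θ : ℝ) :
    HasDerivAt (fun θ => Real.exp (c * θ) * Real.cos θ)
      (Real.exp (c * θ) * Real.sqrt (1 + c ^ 2) * Real.sin (Real.arctan c - θ)) θ := by
  have h1 : HasDerivAt (fun t => Real.exp (c * t)) (Real.exp (c * θ) * c) θ := by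
    simpa using ((hasDerivAt_id θ).const_mul c).exp
  have hp : 0 < Real.sqrt (1 + c ^ 2) := Real.sqrt_pos.2 (by positivity)
  refine (h1.mul (Real.hasDerivAt_cos θ)).congr_deriv ?_
  rw [Real.sin_sub, Real.sin_arctan, Real.cos_arctan]
  field_simp
  ring

theorem strictMonoOn_exp_mul_cos (c : ℝ) :
    StrictMonoOn (fun θ => Real.exp (c * θ) * Real.cos θ)
      (Icc (Real.arctan c - Real.pi) (Real.arctan c)) := by
  refine strictMonoOn_of_deriv_pos (convex_Icc _ _) (by fun_prop) fun θ hθ => ?_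
  rw [interior_Icc] at hθ
  rw [(hasDerivAt_exp_mul_cos c θ).deriv]
  have := Real.sin_pos_of_pos_of_lt_pi (x := Real.arctan c - θ) (by linarith [hθ.2])
    (by linarith [hθ.1])
  positivity

theorem strictMonoOn_exp_mul_cos' (c : ℝ) :
    StrictMonoOn (fun θ => Real.exp (c * θ) * Real.cos θ)
      (Icc (Real.arctan c + Real.pi) (Real.arctan c + 2 * Real.pi)) := by
  refine strictMonoOn_of_deriv_pos (convex_Icc _ _) (by fun_prop) fun θ hθ => ?_
  rw [interior_Icc] at hθ
  rw [(hasDerivAt_exp_mul_cos c θ).deriv]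
  have := Real.sin_pos_of_pos_of_lt_pi (x := Real.arctan c - θ + 2 * Real.pi)
    (by linarith [hθ.2]) (by linarith [hθ.1])
  rw [Real.sin_add_two_pi] at this
  positivity

theorem strictAntiOn_exp_mul_cos (c : ℝ) :
    StrictAntiOn (fun θ => Real.exp (c * θ) * Real.cos θ)
      (Icc (Real.arctan c) (Real.arctan c + Real.pi)) := by
  refine strictAntiOn_of_deriv_neg (convex_Icc _ _) (by fun_prop) fun θ hθ => ?_
  rw [interior_Icc] at hθ
  rw [(hasDerivAt_exp_mul_cos c θ).deriv]
  have := Real.sin_neg_of_neg_of_neg_pi_lt (x := Real.arctan c - θ) (by linarith [hθ.1])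
    (by linarith [hθ.2])
  have hp : 0 < Real.sqrt (1 + c ^ 2) := Real.sqrt_pos.2 (by positivity)
  exact mul_neg_of_pos_of_neg (by positivity) this

theorem spiralV_eq_exp_mul_cos {c d u₀ : ℝ} (hd : 0 < d) (t : ℝ) :
    spiralV c u₀ d t = Real.exp (-(c * Real.arctan (u₀ / d))) * Real.sqrt (d ^ 2 + u₀ ^ 2) *
      (Real.exp (c * (t + Real.arctan (u₀ / d))) * Real.cos (t + Real.arctan (u₀ / d))) := by
  rw [(spiral_polar hd t).1, mul_add, Real.exp_add, Real.exp_neg]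
  field_simp

theorem arctan_lt_arctan_div {c d u : ℝ} (hd : 0 < d) (h : c * d < u) :
    Real.arctan c < Real.arctan (u / d) := Real.arctan_strictMono ((lt_div_iff₀ hd).2 h)

theorem arctan_div_lt_arctan {c d u : ℝ} (hd : 0 < d) (h : u < c * d) :
    Real.arctan (u / d) < Real.arctan c := Real.arctan_strictMono ((div_lt_iff₀ hd).2 h)

/-- On the short arc between two points of the line `v = d` a spiral stays in `v > d`. -/
theorem lt_spiralV_of_short_arc {c d u₀ u₁ τ t : ℝ} (hd : 0 < d) (h0 : u₀ < c * d) (h1 : c * d < u₁)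
    (hτ : τ = Real.arctan (u₁ / d) - Real.arctan (u₀ / d))
    (hr : d ^ 2 + u₁ ^ 2 = Real.exp (2 * c * τ) * (d ^ 2 + u₀ ^ 2)) (ht : t ∈ Ioo 0 τ) :
    d < spiralV c u₀ d t := by
  have hs : spiralV c u₀ d 0 = d := spiralV_zero _ _ _
  have he : spiralV c u₀ d τ = d := (spiral_end hd 0 (by simpa using hτ) hr).1
  have hK : 0 < Real.exp (-(c * Real.arctan (u₀ / d))) * Real.sqrt (d ^ 2 + u₀ ^ 2) :=
    mul_pos (Real.exp_pos _) (Real.sqrt_pos.2 (by positivity))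
  have a0 := arctan_div_lt_arctan hd h0
  have a1 := arctan_lt_arctan_div hd h1
  have b0 := Real.neg_pi_div_two_lt_arctan (u₀ / d)
  have b1 := Real.arctan_lt_pi_div_two (u₁ / d)
  have b2 := Real.neg_pi_div_two_lt_arctan c
  have b3 := Real.arctan_lt_pi_div_two c
  rcases le_total (t + Real.arctan (u₀ / d)) (Real.arctan c) with h | h
  · nth_rewrite 1 [← hs]
    rw [spiralV_eq_exp_mul_cos hd, spiralV_eq_exp_mul_cos hd t]
    refine mul_lt_mul_of_pos_left (strictMonoOn_exp_mul_cos c ⟨?_, ?_⟩ ⟨?_, h⟩ ?_) hK <;>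
    linarith [ht.1]
  · nth_rewrite 1 [← he]
    rw [spiralV_eq_exp_mul_cos hd, spiralV_eq_exp_mul_cos hd t]
    refine mul_lt_mul_of_pos_left (strictAntiOn_exp_mul_cos c ⟨h, ?_⟩ ⟨?_, ?_⟩ ?_) hK <;>
    linarith [ht.2]

/-- On the long arc between two points of the line `v = d` a spiral stays in `v < d`. -/
theorem spiralV_lt_of_long_arc {c d u₀ u₁ τ t : ℝ} (hd : 0 < d) (h0 : c * d < u₀) (h1 : u₁ < c * d)
    (hτ : τ = Real.arctan (u₁ / d) - Real.arctan (u₀ / d) + 2 * Real.pi)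
    (hr : d ^ 2 + u₁ ^ 2 = Real.exp (2 * c * τ) * (d ^ 2 + u₀ ^ 2)) (ht : t ∈ Ioo 0 τ) :
    spiralV c u₀ d t < d := by
  have hs : spiralV c u₀ d 0 = d := spiralV_zero _ _ _
  have he : spiralV c u₀ d τ = d := (spiral_end hd 1 (by simpa using hτ) hr).1
  have hK : 0 < Real.exp (-(c * Real.arctan (u₀ / d))) * Real.sqrt (d ^ 2 + u₀ ^ 2) :=
    mul_pos (Real.exp_pos _) (Real.sqrt_pos.2 (by positivity))
  have a0 := arctan_lt_arctan_div hd h0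
  have a1 := arctan_div_lt_arctan hd h1
  have b0 := Real.arctan_lt_pi_div_two (u₀ / d)
  have b1 := Real.neg_pi_div_two_lt_arctan (u₁ / d)
  have b2 := Real.neg_pi_div_two_lt_arctan c
  have b3 := Real.arctan_lt_pi_div_two c
  rcases le_total (t + Real.arctan (u₀ / d)) (Real.arctan c + Real.pi) with h | h
  · nth_rewrite 2 [← hs]
    rw [spiralV_eq_exp_mul_cos hd, spiralV_eq_exp_mul_cos hd 0]
    refine mul_lt_mul_of_pos_left (strictAntiOn_exp_mul_cos c ⟨?_, ?_⟩ ⟨?_, h⟩ ?_) hK <;>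
    linarith [ht.1]
  · nth_rewrite 2 [← he]
    rw [spiralV_eq_exp_mul_cos hd, spiralV_eq_exp_mul_cos hd τ]
    refine mul_lt_mul_of_pos_left (strictMonoOn_exp_mul_cos' c ⟨h, ?_⟩ ⟨?_, ?_⟩ ?_) hK <;>
    linarith [ht.2]

theorem arctan_div_of_polar {d u r θ : ℝ} (hr : 0 < r)
    (h1 : d = r * Real.cos θ) (h2 : u = r * Real.sin θ) (hl : -(Real.pi / 2) < θ)
    (hu : θ < Real.pi / 2) : θ = Real.arctan (u / d) := by
  rw [h2, h1, mul_div_mul_left _ _ hr.ne', ← Real.tan_eq_sin_div_cos, Real.arctan_tan hl hu]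

/-- The travel time of a spiral excursion from the line `v = d` into `v > d`. -/
theorem time_of_short_excursion {c d u₀ τ : ℝ} (hd : 0 < d) (hτ : 0 < τ)
    (hin : ∀ t ∈ Ioo 0 τ, d < spiralV c u₀ d t) (hend : spiralV c u₀ d τ = d) :
    τ = Real.arctan (spiralU c u₀ d τ / d) - Real.arctan (u₀ / d) := by
  have hpi := Real.pi_pos
  have hneg : spiralV c u₀ d Real.pi < 0 := by
    simp only [spiralV, Real.cos_pi, Real.sin_pi, mul_zero, sub_zero, mul_neg_one]
    exact mul_neg_of_pos_of_neg (Real.exp_pos _) (by linarith)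
  have hlt : τ < Real.pi := by
    by_contra! h
    rcases h.eq_or_lt with h | h
    · rw [← h] at hend; linarith
    · linarith [hin Real.pi ⟨hpi, h⟩]
  have hp := spiral_polar (c := c) (u₀ := u₀) hd τ
  rw [hend] at hp
  have hr : 0 < Real.exp (c * τ) * Real.sqrt (d ^ 2 + u₀ ^ 2) :=
    mul_pos (Real.exp_pos _) (Real.sqrt_pos.2 (by positivity))
  have b0 := Real.neg_pi_div_two_lt_arctan (u₀ / d)
  have b1 := Real.arctan_lt_pi_div_two (u₀ / d)
  have hcos : 0 < Real.cos (τ + Real.arctan (u₀ / d)) :=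
    pos_of_mul_pos_right (hp.1 ▸ hd) hr.le
  have hu : τ + Real.arctan (u₀ / d) < Real.pi / 2 := by
    by_contra! h
    linarith [Real.cos_nonpos_of_pi_div_two_le_of_le h (by linarith)]
  linarith [arctan_div_of_polar hr hp.1 hp.2 (by linarith) hu]

/-- The travel time of an excursion of an expanding spiral from the line `v = d` into `v < d`. -/
theorem time_of_long_excursion {c d u₀ τ : ℝ} (hc : 0 < c) (hd : 0 < d) (hτ : 0 < τ) (hu₀ : 0 < u₀)
    (hin : ∀ t ∈ Ioo 0 τ, spiralV c u₀ d t < d) (hend : spiralV c u₀ d τ = d)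
    (hneg : spiralU c u₀ d τ < 0) :
    τ = Real.arctan (spiralU c u₀ d τ / d) - Real.arctan (u₀ / d) + 2 * Real.pi := by
  have hpi := Real.pi_pos
  have hgt : d < spiralV c u₀ d (2 * Real.pi) := by
    simp only [spiralV, Real.cos_two_pi, Real.sin_two_pi, mul_zero, sub_zero, mul_one]
    have : 1 < Real.exp (c * (2 * Real.pi)) := Real.one_lt_exp_iff.2 (by positivity)
    nlinarith
  have hlt : τ < 2 * Real.pi := by
    by_contra! h
    rcases h.eq_or_lt with h | h
    · rw [← h] at hend; linarith
    · linarith [hin (2 * Real.pi) ⟨by positivity, h⟩]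
  have hp := spiral_polar (c := c) (u₀ := u₀) hd τ
  rw [hend] at hp
  have hr : 0 < Real.exp (c * τ) * Real.sqrt (d ^ 2 + u₀ ^ 2) :=
    mul_pos (Real.exp_pos _) (Real.sqrt_pos.2 (by positivity))
  have b0 : 0 < Real.arctan (u₀ / d) := Real.arctan_pos.2 (by positivity)
  have b1 := Real.arctan_lt_pi_div_two (u₀ / d)
  have hcos : 0 < Real.cos (τ + Real.arctan (u₀ / d)) :=
    pos_of_mul_pos_right (hp.1 ▸ hd) hr.le
  have hsin : Real.sin (τ + Real.arctan (u₀ / d)) < 0 := by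
    by_contra! h
    have := mul_nonneg hr.le h
    linarith [hp.2]
  have hl : Real.pi + Real.pi / 2 < τ + Real.arctan (u₀ / d) := by
    by_contra! h
    rcases le_total (τ + Real.arctan (u₀ / d)) Real.pi with h' | h'
    · linarith [Real.sin_nonneg_of_nonneg_of_le_pi (by linarith) h']
    · linarith [Real.cos_nonpos_of_pi_div_two_le_of_le (x := τ + Real.arctan (u₀ / d))
        (by linarith) (by linarith)]
  have key := arctan_div_of_polar (θ := τ + Real.arctan (u₀ / d) - 2 * Real.pi) (d := d)
    (u := spiralU c u₀ d τ) hr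
    (by rw [Real.cos_sub_two_pi]; exact hp.1)
    (by rw [Real.sin_sub_two_pi]; exact hp.2)
    (by linarith) (by linarith)
  linarith

/-! ### The bifurcation equations -/

/-- The left field is a linear focus in the coordinates `V = (x + 2 y + 1) / 2`, `U = (3 - x) / 2`.
Its equilibrium lies at `U = 2 - leftDist`, so that `leftDist` is the distance in these coordinates
from the equilibrium to the line `x = -1`, that is `U = 2`. The arguments are `α = ε a` and
`k = ε κ`. -/
noncomputable def leftDist (α k : ℝ) : ℝ := 2 + α * k / (1 + α ^ 2)

/-- The `V`-coordinate of the equilibrium of the left field; on the line `x = -1` the coordinate `V`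
is the height `y`. -/
noncomputable def leftShift (α k : ℝ) : ℝ := k / (1 + α ^ 2)

/-- Travel time of the arc in `x > -1` from `(-1, y₀)` to `(-1, -y₁)`. -/
noncomputable def rightTime (y₀ y₁ : ℝ) : ℝ := 2 * Real.pi - Real.arctan y₀ - Real.arctan y₁

/-- Travel time of the arc in `x < -1` from `(-1, -y₁)` to `(-1, y₀)`. -/
noncomputable def leftTime (α k y₀ y₁ : ℝ) : ℝ :=
  Real.arctan ((y₀ - leftShift α k) / leftDist α k) +
    Real.arctan ((y₁ + leftShift α k) / leftDist α k)

/-- The orbit through `(-1, y₀)` of the spiral in `x > -1` comes back at `(-1, -y₁)`. -/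
def RightRel (β y₀ y₁ : ℝ) : Prop :=
  1 + y₁ ^ 2 = Real.exp (2 * β * rightTime y₀ y₁) * (1 + y₀ ^ 2)

/-- The orbit through `(-1, -y₁)` of the spiral in `x < -1` comes back at `(-1, y₀)`. -/
def LeftRel (α k y₀ y₁ : ℝ) : Prop :=
  leftDist α k ^ 2 + (y₀ - leftShift α k) ^ 2 =
    Real.exp (2 * α * leftTime α k y₀ y₁) * (leftDist α k ^ 2 + (y₁ + leftShift α k) ^ 2)

/-- `sinh x / x`, with the value `1` at `0`. -/
noncomputable def sinhDiv : ℝ → ℝ := dslope Real.sinh 0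

theorem mul_sinhDiv (x : ℝ) : x * sinhDiv x = Real.sinh x := by
  simpa [sinhDiv] using sub_smul_dslope Real.sinh 0 x

theorem sinhDiv_zero : sinhDiv 0 = 1 := by
  simp [sinhDiv, dslope_same]

theorem contDiffAt_sinhDiv : ContDiffAt ℝ 1 sinhDiv 0 := by
  have h : AnalyticAt ℝ Real.sinh 0 := by
    exact Real.analyticAt_sinh
  obtain ⟨p, hp⟩ := h
  exact (hp.has_fpower_series_dslope_fslope.analyticAt).contDiffAt

/-- `P = e^{2x} Q` in terms of the mean and the half difference of `P` and `Q`. -/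
theorem add_eq_exp_mul_sub_iff (s d x : ℝ) :
    s + d = Real.exp (2 * x) * (s - d) ↔ d * Real.cosh x = s * Real.sinh x := by
  have h1 : Real.exp (2 * x) = Real.exp x * Real.exp x := by rw [← Real.exp_add]; congr 1; ring
  have h2 : Real.exp x * Real.exp (-x) = 1 := by rw [← Real.exp_add]; simp
  rw [Real.cosh_eq, Real.sinh_eq, h1]
  constructor
  · intro h
    linear_combination Real.exp (-x) / 2 * h + (Real.exp x / 2 * (s - d)) * h2
  · intro h
    linear_combination 2 * Real.exp x * h - (s + d) * h2

/-- The displacement equation of the right half return, divided by `ε`; the unknowns are the mean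
`m` of the two crossing heights and their half difference divided by `ε`. -/
noncomputable def rightEq (b : ℝ) (p : ℝ × (ℝ × ℝ)) : ℝ :=
  2 * p.2.1 * p.2.2 * Real.cosh (p.1 * (b * rightTime (p.2.1 - p.1 * p.2.2) (p.2.1 + p.1 * p.2.2)))
    - (1 + p.2.1 ^ 2 + (p.1 * p.2.2) ^ 2) *
      (b * rightTime (p.2.1 - p.1 * p.2.2) (p.2.1 + p.1 * p.2.2) *
        sinhDiv (p.1 * (b * rightTime (p.2.1 - p.1 * p.2.2) (p.2.1 + p.1 * p.2.2))))

/-- The displacement equation of the left half return, divided by `ε`. The shift of the equilibrium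
is `leftShift (ε a) (ε κ) = ε * leftShift (ε a) κ`, which is where the factor `ε` comes from. -/
noncomputable def leftEq (a κ : ℝ) (p : ℝ × (ℝ × ℝ)) : ℝ :=
  2 * p.2.1 * (p.2.2 + leftShift (p.1 * a) κ) * Real.cosh (p.1 * (a *
      leftTime (p.1 * a) (p.1 * κ) (p.2.1 - p.1 * p.2.2) (p.2.1 + p.1 * p.2.2)))
    + (leftDist (p.1 * a) (p.1 * κ) ^ 2 + p.2.1 ^ 2 +
        (p.1 * (p.2.2 + leftShift (p.1 * a) κ)) ^ 2) *
      (a * leftTime (p.1 * a) (p.1 * κ) (p.2.1 - p.1 * p.2.2) (p.2.1 + p.1 * p.2.2) *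
        sinhDiv (p.1 * (a *
          leftTime (p.1 * a) (p.1 * κ) (p.2.1 - p.1 * p.2.2) (p.2.1 + p.1 * p.2.2))))

theorem rightEq_eq_zero_iff {b ε m δ : ℝ} (hε : ε ≠ 0) :
    rightEq b (ε, (m, δ)) = 0 ↔ RightRel (ε * b) (m - ε * δ) (m + ε * δ) := by
  simp only [rightEq, RightRel]
  set X := rightTime (m - ε * δ) (m + ε * δ)
  have h := mul_sinhDiv (ε * (b * X))
  have key := add_eq_exp_mul_sub_iff (1 + m ^ 2 + (ε * δ) ^ 2) (2 * m * (ε * δ)) (ε * (b * X))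
  rw [show 1 + (m + ε * δ) ^ 2 = 1 + m ^ 2 + (ε * δ) ^ 2 + 2 * m * (ε * δ) by ring,
    show 1 + (m - ε * δ) ^ 2 = 1 + m ^ 2 + (ε * δ) ^ 2 - 2 * m * (ε * δ) by ring,
    show 2 * (ε * b) * X = 2 * (ε * (b * X)) by ring, key, ← h]
  constructor
  · intro h
    linear_combination ε * h
  · intro h
    refine mul_left_cancel₀ hε ?_
    linear_combination h

theorem leftEq_eq_zero_iff {a κ ε m δ : ℝ} (hε : ε ≠ 0) :
    leftEq a κ (ε, (m, δ)) = 0 ↔ LeftRel (ε * a) (ε * κ) (m - ε * δ) (m + ε * δ) := by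
  simp only [leftEq, LeftRel]
  set X := leftTime (ε * a) (ε * κ) (m - ε * δ) (m + ε * δ)
  set d := leftDist (ε * a) (ε * κ)
  have hs : leftShift (ε * a) (ε * κ) = ε * leftShift (ε * a) κ := by
    simp only [leftShift]; ring
  rw [hs]
  set σ := leftShift (ε * a) κ
  have h := mul_sinhDiv (ε * (a * X))
  have key := add_eq_exp_mul_sub_iff (d ^ 2 + m ^ 2 + (ε * (δ + σ)) ^ 2)
    (-(2 * m * (ε * (δ + σ)))) (ε * (a * X))
  rw [show d ^ 2 + (m - ε * δ - ε * σ) ^ 2 =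
      d ^ 2 + m ^ 2 + (ε * (δ + σ)) ^ 2 + -(2 * m * (ε * (δ + σ))) by ring,
    show d ^ 2 + (m + ε * δ + ε * σ) ^ 2 =
      d ^ 2 + m ^ 2 + (ε * (δ + σ)) ^ 2 - -(2 * m * (ε * (δ + σ))) by ring,
    show 2 * (ε * a) * X = 2 * (ε * (a * X)) by ring, key, ← h]
  constructor
  · intro h
    linear_combination -ε * h
  · intro h
    refine mul_left_cancel₀ hε ?_
    linear_combination -h

theorem contDiffAt_rightEq (b m δ : ℝ) : ContDiffAt ℝ 1 (rightEq b) (0, (m, δ)) := by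
  have hX : ContDiffAt ℝ 1 (fun p : ℝ × (ℝ × ℝ) =>
      b * rightTime (p.2.1 - p.1 * p.2.2) (p.2.1 + p.1 * p.2.2)) (0, (m, δ)) := by
    unfold rightTime
    have h0 : ContDiffAt ℝ 1 (fun p : ℝ × (ℝ × ℝ) => p.2.1 - p.1 * p.2.2) (0, (m, δ)) := by
      fun_prop
    have h1 : ContDiffAt ℝ 1 (fun p : ℝ × (ℝ × ℝ) => p.2.1 + p.1 * p.2.2) (0, (m, δ)) := by
      fun_prop
    exact contDiffAt_const.mul ((contDiffAt_const.sub h0.arctan).sub h1.arctan)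
  have hε : ContDiffAt ℝ 1 (fun p : ℝ × (ℝ × ℝ) => p.1) (0, (m, δ)) := by fun_prop
  have hS : ContDiffAt ℝ 1 (fun p : ℝ × (ℝ × ℝ) => sinhDiv (p.1 *
      (b * rightTime (p.2.1 - p.1 * p.2.2) (p.2.1 + p.1 * p.2.2)))) (0, (m, δ)) := by
    refine ContDiffAt.comp (g := sinhDiv) _ ?_ (hε.mul hX)
    simpa using contDiffAt_sinhDiv
  have hC := (hε.mul hX).cosh
  have hA : ContDiffAt ℝ 1 (fun p : ℝ × (ℝ × ℝ) => 2 * p.2.1 * p.2.2) (0, (m, δ)) := by fun_prop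
  have hB : ContDiffAt ℝ 1 (fun p : ℝ × (ℝ × ℝ) => 1 + p.2.1 ^ 2 + (p.1 * p.2.2) ^ 2)
    (0, (m, δ)) := by fun_prop
  exact (hA.mul hC).sub (hB.mul (hX.mul hS))

theorem contDiffAt_leftEq (a κ m δ : ℝ) : ContDiffAt ℝ 1 (leftEq a κ) (0, (m, δ)) := by
  have hs : ∀ k : ℝ, ContDiffAt ℝ 1 (fun p : ℝ × (ℝ × ℝ) => leftShift (p.1 * a) k) (0, (m, δ)) := by
    intro k
    unfold leftShift
    exact ContDiffAt.div (by fun_prop) (by fun_prop) (by positivity)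
  have hs' : ContDiffAt ℝ 1 (fun p : ℝ × (ℝ × ℝ) => leftShift (p.1 * a) (p.1 * κ))
      (0, (m, δ)) := by
    unfold leftShift
    exact ContDiffAt.div (by fun_prop) (by fun_prop) (by positivity)
  have hd : ContDiffAt ℝ 1 (fun p : ℝ × (ℝ × ℝ) => leftDist (p.1 * a) (p.1 * κ))
      (0, (m, δ)) := by
    unfold leftDist
    exact contDiffAt_const.add (ContDiffAt.div (by fun_prop) (by fun_prop) (by positivity))
  have hd0 : leftDist (0 * a) (0 * κ) ≠ 0 := by simp [leftDist]
  have hε : ContDiffAt ℝ 1 (fun p : ℝ × (ℝ × ℝ) => p.1) (0, (m, δ)) := by fun_prop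
  have hy0 : ContDiffAt ℝ 1 (fun p : ℝ × (ℝ × ℝ) => p.2.1 - p.1 * p.2.2) (0, (m, δ)) := by fun_prop
  have hy1 : ContDiffAt ℝ 1 (fun p : ℝ × (ℝ × ℝ) => p.2.1 + p.1 * p.2.2) (0, (m, δ)) := by fun_prop
  have hX : ContDiffAt ℝ 1 (fun p : ℝ × (ℝ × ℝ) => a *
      leftTime (p.1 * a) (p.1 * κ) (p.2.1 - p.1 * p.2.2) (p.2.1 + p.1 * p.2.2)) (0, (m, δ)) := by
    unfold leftTime
    exact contDiffAt_const.mul ((((hy0.sub hs').div hd hd0).arctan).add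
      (((hy1.add hs').div hd hd0).arctan))
  have hS : ContDiffAt ℝ 1 (fun p : ℝ × (ℝ × ℝ) => sinhDiv (p.1 * (a *
      leftTime (p.1 * a) (p.1 * κ) (p.2.1 - p.1 * p.2.2) (p.2.1 + p.1 * p.2.2)))) (0, (m, δ)) := by
    refine ContDiffAt.comp (g := sinhDiv) _ ?_ (hε.mul hX)
    simpa using contDiffAt_sinhDiv
  have hC := (hε.mul hX).cosh
  have hm : ContDiffAt ℝ 1 (fun p : ℝ × (ℝ × ℝ) => p.2.1) (0, (m, δ)) := by fun_prop
  have hδ : ContDiffAt ℝ 1 (fun p : ℝ × (ℝ × ℝ) => p.2.2) (0, (m, δ)) := by fun_prop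
  have hA := (contDiffAt_const (c := (2 : ℝ))).mul hm |>.mul (hδ.add (hs κ))
  have hB := ((hd.pow 2).add (hm.pow 2)).add ((hε.mul (hδ.add (hs κ))).pow 2)
  exact (hA.mul hC).add (hB.mul (hX.mul hS))

/-- The contribution of the zones `x > -1` to the Melnikov function. -/
noncomputable def rightMelnikov (b m : ℝ) : ℝ :=
  (1 + m ^ 2) * (b * (2 * Real.pi - 2 * Real.arctan m))

/-- The contribution of the divergence in the zone `x < -1` to the Melnikov function. -/
noncomputable def leftMelnikov (a m : ℝ) : ℝ := (4 + m ^ 2) * (a * (2 * Real.arctan (m / 2)))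

/-- The Melnikov function of the perturbation. -/
noncomputable def melnikov (a b κ m : ℝ) : ℝ := 2 * κ * m + rightMelnikov b m + leftMelnikov a m

theorem differentiable_rightMelnikov (b : ℝ) : Differentiable ℝ (rightMelnikov b) := by
  have h := Real.differentiable_arctan
  unfold rightMelnikov; fun_prop

theorem differentiable_leftMelnikov (a : ℝ) : Differentiable ℝ (leftMelnikov a) := by
  have h : Differentiable ℝ fun m : ℝ => Real.arctan (m / 2) :=
    Real.differentiable_arctan.comp (by fun_prop)
  unfold leftMelnikov; fun_prop

theorem rightEq_zero (b m δ : ℝ) : rightEq b (0, (m, δ)) = 2 * m * δ - rightMelnikov b m := by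
  simp only [rightEq, rightMelnikov, rightTime, sinhDiv_zero, zero_mul, Real.cosh_zero, sub_zero,
    add_zero]
  ring

theorem leftEq_zero (a κ m δ : ℝ) :
    leftEq a κ (0, (m, δ)) = 2 * m * (δ + κ) + leftMelnikov a m := by
  simp [leftEq, leftMelnikov, leftTime, leftDist, leftShift, sinhDiv_zero]; ring

theorem isInvertible_of_injective {f : (ℝ × ℝ) →L[ℝ] (ℝ × ℝ)} (h : ∀ q, f q = 0 → q = 0) :
    f.IsInvertible := by
  have hi : Function.Injective (f : (ℝ × ℝ) →ₗ[ℝ] (ℝ × ℝ)) :=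
    (injective_iff_map_eq_zero (f : (ℝ × ℝ) →ₗ[ℝ] (ℝ × ℝ))).2 h
  refine ⟨(LinearEquiv.ofInjectiveEndo _ hi).toContinuousLinearEquiv, ?_⟩
  ext <;> rfl

/-- Simple zeros of the Melnikov function persist: for small `ε > 0` the bifurcation equations have
a solution near `(h, h)`, which is isolated for each `ε`. -/
theorem exists_branch {a b κ h : ℝ} (hh : 0 < h) (hW : melnikov a b κ h = 0)
    (hW' : deriv (melnikov a b κ) h ≠ 0) :
    ∃ y₀ y₁ : ℝ → ℝ, Tendsto y₀ (𝓝[>] 0) (𝓝 h) ∧ Tendsto y₁ (𝓝[>] 0) (𝓝 h) ∧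
      ∀ᶠ ε in 𝓝[>] (0 : ℝ), (RightRel (ε * b) (y₀ ε) (y₁ ε) ∧
        LeftRel (ε * a) (ε * κ) (y₀ ε) (y₁ ε)) ∧
        ∀ᶠ q in 𝓝 (y₀ ε, y₁ ε), RightRel (ε * b) q.1 q.2 → LeftRel (ε * a) (ε * κ) q.1 q.2 →
          q = (y₀ ε, y₁ ε) := by
  obtain ⟨δ, hδ⟩ : ∃ δ, 2 * h * δ = rightMelnikov b h :=
    ⟨rightMelnikov b h / (2 * h), by field_simp⟩
  set Φ : ℝ × (ℝ × ℝ) → ℝ × ℝ := fun p => (rightEq b p, leftEq a κ p) with hΦ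
  have hΦ0 : Φ (0, (h, δ)) = 0 := by
    simp only [hΦ, rightEq_zero, leftEq_zero, Prod.mk_eq_zero]
    refine ⟨by linarith, ?_⟩
    rw [melnikov] at hW
    linarith
  have hsd : HasStrictFDerivAt Φ (fderiv ℝ Φ (0, (h, δ))) (0, (h, δ)) :=
    ((contDiffAt_rightEq b h δ).prodMk (contDiffAt_leftEq a κ h δ)).hasStrictFDerivAt one_ne_zero
  have hK1 := (differentiable_rightMelnikov b h).hasDerivAt
  have hK2 := (differentiable_leftMelnikov a h).hasDerivAt
  set K1 := deriv (rightMelnikov b) h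
  set K2 := deriv (leftMelnikov a) h
  have hdet : 2 * κ + K1 + K2 ≠ 0 := by
    have : HasDerivAt (melnikov a b κ) (2 * κ + K1 + K2) h :=
      ((((hasDerivAt_id h).const_mul (2 * κ)).congr_deriv (mul_one _)).add hK1).add hK2
    rwa [this.deriv] at hW'
  -- the partial derivative in the unknowns, along a ray
  have hray : ∀ q : ℝ × ℝ, fderiv ℝ Φ (0, (h, δ)) (0, q) =
      (2 * q.1 * δ + 2 * h * q.2 - K1 * q.1, 2 * q.1 * (δ + κ) + 2 * h * q.2 + K2 * q.1) := by
    intro q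
    have hl : HasDerivAt (fun t : ℝ => ((0 : ℝ), (h + t * q.1, δ + t * q.2))) (0, q) 0 := by
      refine (hasDerivAt_const _ _).prodMk (HasDerivAt.prodMk ?_ ?_)
      · simpa using ((hasDerivAt_id (0 : ℝ)).mul_const q.1).const_add h
      · simpa using ((hasDerivAt_id (0 : ℝ)).mul_const q.2).const_add δ
    have h1 : HasDerivAt (fun t : ℝ => Φ ((0 : ℝ), (h + t * q.1, δ + t * q.2)))
        (fderiv ℝ Φ (0, (h, δ)) (0, q)) 0 := by
      refine HasFDerivAt.comp_hasDerivAt (l := Φ) 0 ?_ hl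
      simpa using hsd.hasFDerivAt
    have hm : HasDerivAt (fun t : ℝ => h + t * q.1) q.1 0 := by
      simpa using ((hasDerivAt_id (0 : ℝ)).mul_const q.1).const_add h
    have hd : HasDerivAt (fun t : ℝ => δ + t * q.2) q.2 0 := by
      simpa using ((hasDerivAt_id (0 : ℝ)).mul_const q.2).const_add δ
    have hc1 : HasDerivAt (fun t : ℝ => rightMelnikov b (h + t * q.1)) (K1 * q.1) 0 :=
      HasDerivAt.comp (h₂ := rightMelnikov b) 0 (by simpa using hK1) hm
    have hc2 : HasDerivAt (fun t : ℝ => leftMelnikov a (h + t * q.1)) (K2 * q.1) 0 :=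
      HasDerivAt.comp (h₂ := leftMelnikov a) 0 (by simpa using hK2) hm
    have h2 : HasDerivAt (fun t : ℝ => Φ ((0 : ℝ), (h + t * q.1, δ + t * q.2)))
        (2 * q.1 * δ + 2 * h * q.2 - K1 * q.1, 2 * q.1 * (δ + κ) + 2 * h * q.2 + K2 * q.1) 0 := by
      simp only [hΦ, rightEq_zero, leftEq_zero]
      refine HasDerivAt.prodMk ?_ ?_
      · exact (((hm.const_mul 2).mul hd).sub hc1).congr_deriv (by simp)
      · exact (((hm.const_mul 2).mul (hd.add_const κ)).add hc2).congr_deriv (by simp)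
    exact h1.unique h2
  have hinv : (fderiv ℝ Φ (0, (h, δ)) ∘L .inr ℝ ℝ (ℝ × ℝ)).IsInvertible := by
    refine isInvertible_of_injective fun q hq => ?_
    rw [ContinuousLinearMap.comp_apply, ContinuousLinearMap.inr_apply, hray, Prod.mk_eq_zero] at hq
    have hx : q.1 = 0 := by
      have : (2 * κ + K1 + K2) * q.1 = 0 := by linear_combination hq.2 - hq.1
      exact (mul_eq_zero.1 this).resolve_left hdet
    have hy : q.2 = 0 := by
      have : (2 * h) * q.2 = 0 := by
        have := hq.1
        rw [hx] at this
        linear_combination this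
      exact (mul_eq_zero.1 this).resolve_left (by positivity)
    exact Prod.ext hx hy
  set ψ := hsd.implicitFunctionOfProdDomain hinv
  have hψ : Tendsto ψ (𝓝 0) (𝓝 (h, δ)) := hsd.tendsto_implicitFunctionOfProdDomain hinv
  have hψ0 : ∀ᶠ ε in 𝓝 (0 : ℝ), Φ (ε, ψ ε) = 0 := by
    filter_upwards [hsd.eventually_apply_implicitFunctionOfProdDomain hinv] with ε hε
    rw [hε, hΦ0]
  have hψu : ∀ᶠ v in 𝓝 ((0 : ℝ), (h, δ)), Φ v = 0 → ψ v.1 = v.2 := by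
    filter_upwards [hsd.eventually_apply_eq_iff_implicitFunctionOfProdDomain hinv] with v hv h0
    exact hv.1 (by rw [h0, hΦ0])
  have hψu' : ∀ᶠ ε in 𝓝 (0 : ℝ), ∀ᶠ v in 𝓝 (ε, ψ ε), Φ v = 0 → ψ v.1 = v.2 :=
    (tendsto_id.prodMk_nhds hψ).eventually hψu.eventually_nhds
  have hψ1 : Tendsto (fun ε => (ψ ε).1) (𝓝 0) (𝓝 h) := (continuous_fst.tendsto (h, δ)).comp hψ
  have hψ2 : Tendsto (fun ε => (ψ ε).2) (𝓝 0) (𝓝 δ) := (continuous_snd.tendsto (h, δ)).comp hψ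
  refine ⟨fun ε => (ψ ε).1 - ε * (ψ ε).2, fun ε => (ψ ε).1 + ε * (ψ ε).2, ?_, ?_, ?_⟩
  · refine Tendsto.mono_left ?_ nhdsWithin_le_nhds
    simpa using hψ1.sub (tendsto_id.mul hψ2)
  · refine Tendsto.mono_left ?_ nhdsWithin_le_nhds
    simpa using hψ1.add (tendsto_id.mul hψ2)
  filter_upwards [hψ0.filter_mono nhdsWithin_le_nhds, hψu'.filter_mono nhdsWithin_le_nhds,
    self_mem_nhdsWithin] with ε h0 hu hε
  have hε : ε ≠ 0 := (mem_Ioi.1 hε).ne'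
  have hsplit : ∀ m d : ℝ, Φ (ε, (m, d)) = 0 ↔ RightRel (ε * b) (m - ε * d) (m + ε * d) ∧
      LeftRel (ε * a) (ε * κ) (m - ε * d) (m + ε * d) := fun m d => by
    rw [← rightEq_eq_zero_iff hε, ← leftEq_eq_zero_iff hε, hΦ, Prod.mk_eq_zero]
  refine ⟨(hsplit _ _).1 h0, ?_⟩
  have hcont : Tendsto (fun q : ℝ × ℝ => (ε, ((q.1 + q.2) / 2, (q.2 - q.1) / (2 * ε))))
      (𝓝 ((ψ ε).1 - ε * (ψ ε).2, (ψ ε).1 + ε * (ψ ε).2)) (𝓝 (ε, ψ ε)) := by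
    have hc : Continuous fun q : ℝ × ℝ => (ε, ((q.1 + q.2) / 2, (q.2 - q.1) / (2 * ε))) := by
      fun_prop
    convert hc.tendsto _ using 3
    ext
    · simp
    · simp; field_simp; ring
  filter_upwards [hcont.eventually hu] with q hq hR hL
  have e1 : (q.1 + q.2) / 2 - ε * ((q.2 - q.1) / (2 * ε)) = q.1 := by field_simp; ring
  have e2 : (q.1 + q.2) / 2 + ε * ((q.2 - q.1) / (2 * ε)) = q.2 := by field_simp; ring
  have := hq ((hsplit _ _).2 (by rw [e1, e2]; exact ⟨hR, hL⟩))
  rw [this]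
  exact Prod.ext e1.symm e2.symm

/-! ### The perturbed system and its two arcs -/

/-- The perturbation: in `x > -1` a radial expansion about the origin, in `x < -1` a radial field
of divergence `2 a` about the virtual center together with a constant drift. -/
def pert (a b κ : ℝ) : Zone → PertCoeffs
  | .L => { p := a, q := 0, r := -3 * a - 2 * κ, s := 0, u := a, v := 2 * a + κ }
  | .C => { p := b, q := 0, r := 0, s := 0, u := b, v := 0 }
  | .R => { p := b, q := 0, r := 0, s := 0, u := b, v := 0 }

/-- The perturbed fields in closed form, with `α = ε a`, `β = ε b`, `k = ε κ`. -/
def vf (α β k : ℝ) : Zone → ℝ × ℝ → ℝ × ℝ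
  | .L => fun P => (P.1 + 2 * P.2 + 1 + α * P.1 - 3 * α - 2 * k,
      1 - P.1 - P.2 + α * P.2 + 2 * α + k)
  | .C => fun P => (P.2 + β * P.1, -P.1 + β * P.2)
  | .R => fun P => (P.2 + β * P.1, -P.1 + β * P.2)

theorem system_pert (a b κ ε : ℝ) :
    system virtualCenters (pert a b κ) ε = vf (ε * a) (ε * b) (ε * κ) := by
  funext z P
  cases z <;> simp only [system, field_eq, virtualCenters, normalForm, pert, vf] <;>
    ext <;> simp <;> ring

theorem system_zero (w : Zone → PertCoeffs) : system virtualCenters w 0 = vf 0 0 0 := by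
  funext z P
  cases z <;> simp only [system, field_eq, virtualCenters, normalForm, vf] <;>
    ext <;> simp <;> ring

/-- The orbit of the fields in `x > -1` that starts at `(-1, y₀)`. -/
noncomputable def rightArc (β y₀ t : ℝ) : ℝ × ℝ := (-spiralV β y₀ 1 t, spiralU β y₀ 1 t)

/-- The orbit of the field in `x < -1` that starts at `(-1, -y₁)`. In the coordinates
`u = (x + 2 y + 1) / 2 - leftShift`, `v = leftDist - (x + 1) / 2` it is a spiral. -/
noncomputable def leftArc (α k y₁ t : ℝ) : ℝ × ℝ :=
  (-1 - 2 * (spiralV α (-(y₁ + leftShift α k)) (leftDist α k) t - leftDist α k),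
    spiralU α (-(y₁ + leftShift α k)) (leftDist α k) t + leftShift α k +
      (spiralV α (-(y₁ + leftShift α k)) (leftDist α k) t - leftDist α k))

theorem hasDerivAt_rightArc (α β k y₀ t : ℝ) :
    HasDerivAt (rightArc β y₀) (vf α β k .C (rightArc β y₀ t)) t := by
  refine ((hasDerivAt_spiralV β y₀ 1 t).neg.prodMk (hasDerivAt_spiralU β y₀ 1 t)).congr_deriv ?_
  simp only [vf, rightArc]
  ext <;> simp <;> ring

theorem leftDist_eq (α k : ℝ) : leftDist α k = 2 + α * leftShift α k := by
  simp only [leftDist, leftShift]; ring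

theorem leftShift_mul (α k : ℝ) : leftShift α k * (1 + α ^ 2) = k := by
  have : (1 + α ^ 2) ≠ 0 := by positivity
  simp only [leftShift]; field_simp

/-- Where the `x`-component of the left field vanishes on `x = -1`. -/
theorem mul_leftDist_add (α k : ℝ) : α * leftDist α k + leftShift α k = 2 * α + k := by
  linear_combination α * leftDist_eq α k + leftShift_mul α k

theorem hasDerivAt_leftArc (α β k y₁ t : ℝ) :
    HasDerivAt (leftArc α k y₁) (vf α β k .L (leftArc α k y₁ t)) t := by
  have hv := hasDerivAt_spiralV α (-(y₁ + leftShift α k)) (leftDist α k) t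
  have hu := hasDerivAt_spiralU α (-(y₁ + leftShift α k)) (leftDist α k) t
  have h1 := ((hv.sub_const (leftDist α k)).const_mul 2).const_sub (-1)
  have h2 := (hu.add_const (leftShift α k)).add (hv.sub_const (leftDist α k))
  refine (h1.prodMk h2).congr_deriv ?_
  have e := mul_leftDist_add α k
  have e' := leftDist_eq α k
  simp only [vf, leftArc]
  ext
  · simp; linear_combination -2 * e
  · simp; linear_combination e + e'

/-- The inequalities and equations which say that `(-1, y₀)` and `(-1, -y₁)` are the two crossing
points of a periodic orbit on the line `x = -1`. -/
structure CycleData (α β k y₀ y₁ : ℝ) : Prop where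
  nonneg : 0 ≤ β
  pos₁ : 0 < y₁
  right_up : β < y₀
  left_pos : 0 < leftDist α k
  left_up : 2 * α + k < y₀
  left_down : -y₁ < 2 * α + k
  right_rel : RightRel β y₀ y₁
  left_rel : LeftRel α k y₀ y₁

/-- The union of the two arcs between `(-1, y₀)` and `(-1, -y₁)`. -/
noncomputable def cycle (α β k y₀ y₁ : ℝ) : Set (ℝ × ℝ) :=
  rightArc β y₀ '' Icc 0 (rightTime y₀ y₁) ∪ leftArc α k y₁ '' Icc 0 (leftTime α k y₀ y₁)

theorem rightTime_pos (y₀ y₁ : ℝ) : 0 < rightTime y₀ y₁ := by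
  have := Real.arctan_lt_pi_div_two y₀
  have := Real.arctan_lt_pi_div_two y₁
  have := Real.pi_pos
  simp only [rightTime]; linarith

theorem rightArc_zero (β y₀ : ℝ) : rightArc β y₀ 0 = (-1, y₀) := by simp [rightArc]

theorem leftArc_zero (α k y₁ : ℝ) : leftArc α k y₁ 0 = (-1, -y₁) := by
  simp [leftArc]

theorem rightTime_eq (y₀ y₁ : ℝ) :
    rightTime y₀ y₁ = Real.arctan (-y₁ / 1) - Real.arctan (y₀ / 1) + 2 * Real.pi := by
  simp only [rightTime, div_one, Real.arctan_neg]; ring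

theorem leftTime_eq (α k y₀ y₁ : ℝ) :
    leftTime α k y₀ y₁ = Real.arctan ((y₀ - leftShift α k) / leftDist α k) -
      Real.arctan (-(y₁ + leftShift α k) / leftDist α k) := by
  simp only [leftTime, neg_div, Real.arctan_neg]; ring

namespace CycleData

variable {α β k y₀ y₁ : ℝ}

theorem pos₀ (h : CycleData α β k y₀ y₁) : 0 < y₀ := h.nonneg.trans_lt h.right_up

theorem left_up' (h : CycleData α β k y₀ y₁) : α * leftDist α k < y₀ - leftShift α k := by
  linarith [h.left_up, mul_leftDist_add α k]

theorem left_down' (h : CycleData α β k y₀ y₁) :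
    -(y₁ + leftShift α k) < α * leftDist α k := by
  linarith [h.left_down, mul_leftDist_add α k]

theorem leftTime_pos (h : CycleData α β k y₀ y₁) : 0 < leftTime α k y₀ y₁ := by
  rw [leftTime_eq]
  linarith [arctan_lt_arctan_div h.left_pos h.left_up',
    arctan_div_lt_arctan h.left_pos h.left_down']

theorem right_rel' (h : CycleData α β k y₀ y₁) : (1 : ℝ) ^ 2 + (-y₁) ^ 2 =
    Real.exp (2 * β * rightTime y₀ y₁) * (1 ^ 2 + y₀ ^ 2) := by
  simpa [RightRel] using h.right_rel

theorem left_rel' (h : CycleData α β k y₀ y₁) :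
    leftDist α k ^ 2 + (y₀ - leftShift α k) ^ 2 =
    Real.exp (2 * α * leftTime α k y₀ y₁) * (leftDist α k ^ 2 + (-(y₁ + leftShift α k)) ^ 2) := by
  rw [neg_sq]; exact h.left_rel

theorem rightArc_end (h : CycleData α β k y₀ y₁) : rightArc β y₀ (rightTime y₀ y₁) = (-1, -y₁) := by
  obtain ⟨h1, h2⟩ := spiral_end one_pos 1 (by simpa using rightTime_eq y₀ y₁) h.right_rel'
  rw [rightArc, h1, h2]

theorem leftArc_end (h : CycleData α β k y₀ y₁) :
    leftArc α k y₁ (leftTime α k y₀ y₁) = (-1, y₀) := by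
  obtain ⟨h1, h2⟩ := spiral_end h.left_pos 0 (by simpa using leftTime_eq α k y₀ y₁) h.left_rel'
  rw [leftArc, h1, h2]
  simp

theorem lt_rightArc (h : CycleData α β k y₀ y₁) {t : ℝ} (ht : t ∈ Ioo 0 (rightTime y₀ y₁)) :
    -1 < (rightArc β y₀ t).1 := by
  have := spiralV_lt_of_long_arc one_pos (by linarith [h.right_up])
    (by linarith [h.nonneg, h.pos₁]) (rightTime_eq y₀ y₁) h.right_rel' ht
  simp only [rightArc]; linarith

theorem leftArc_lt (h : CycleData α β k y₀ y₁) {t : ℝ} (ht : t ∈ Ioo 0 (leftTime α k y₀ y₁)) :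
    (leftArc α k y₁ t).1 < -1 := by
  have := lt_spiralV_of_short_arc h.left_pos h.left_down' h.left_up' (leftTime_eq α k y₀ y₁)
    h.left_rel' ht
  simp only [leftArc]; linarith

/-- The right arc is transverse to `x = 1`: its radius does not decrease, so that `|y| ≥ y₀ > β`
there. -/
theorem rightArc_transverse (h : CycleData α β k y₀ y₁) {t : ℝ} (ht : 0 ≤ t)
    (hx : (rightArc β y₀ t).1 = 1) : (vf α β k .C (rightArc β y₀ t)).1 ≠ 0 := by
  have hsq := spiral_sq β y₀ 1 t
  have he : 1 ≤ Real.exp (2 * β * t) := Real.one_le_exp (by have := h.nonneg; positivity)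
  simp only [rightArc] at hx
  simp only [vf, rightArc]
  intro h0
  have hu : spiralU β y₀ 1 t = -β := by rw [hx] at h0; linarith
  have hv : spiralV β y₀ 1 t = -1 := by linarith
  rw [hu, hv] at hsq
  nlinarith [h.right_up, h.nonneg, h.pos₀, sq_nonneg y₀]

end CycleData

/-! ### Closing two arcs up to a periodic solution -/

/-- The curve of period `τ + τ'` that runs through `p` on `[0, τ]` and through `q` on `[0, τ']`. -/
noncomputable def loop (p q : ℝ → ℝ × ℝ) (τ τ' t : ℝ) : ℝ × ℝ :=
  if Int.fract (t / (τ + τ')) * (τ + τ') ≤ τ then p (Int.fract (t / (τ + τ')) * (τ + τ'))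
  else q (Int.fract (t / (τ + τ')) * (τ + τ') - τ)

section loop

variable {p q : ℝ → ℝ × ℝ} {τ τ' : ℝ}

theorem loop_periodic (hT : 0 < τ + τ') : Function.Periodic (loop p q τ τ') (τ + τ') := by
  intro t
  have : (t + (τ + τ')) / (τ + τ') = t / (τ + τ') + 1 := by field_simp
  simp only [loop, this, Int.fract_add_one]

theorem fract_mul_of_mem {T s : ℝ} (n : ℤ) (h0 : 0 ≤ s) (h1 : s < T) :
    Int.fract ((n * T + s) / T) * T = s := by
  have hT : 0 < T := h0.trans_lt h1
  have e : (n * T + s) / T = n + s / T := by field_simp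
  rw [e, Int.fract_intCast_add, Int.fract_eq_self.2 ⟨by positivity, (div_lt_one hT).2 h1⟩]
  field_simp

theorem loop_first (hτ' : 0 < τ') (n : ℤ) {s : ℝ} (hs : s ∈ Icc 0 τ) :
    loop p q τ τ' (n * (τ + τ') + s) = p s := by
  rw [loop, fract_mul_of_mem n hs.1 (by linarith [hs.2]), if_pos hs.2]

theorem loop_second (hτ : 0 < τ) (hτ' : 0 < τ') (h0 : p 0 = q τ') (h1 : p τ = q 0) (n : ℤ) {s : ℝ}
    (hs : s ∈ Icc 0 τ') : loop p q τ τ' (n * (τ + τ') + τ + s) = q s := by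
  rcases hs.2.lt_or_eq with h | h
  · rcases hs.1.lt_or_eq with h' | h'
    · rw [add_assoc, loop, fract_mul_of_mem n (by linarith) (by linarith), if_neg (by linarith)]
      congr 1; ring
    · rw [← h', add_zero, loop_first hτ' n ⟨hτ.le, le_rfl⟩, h1]
  · have := loop_first (p := p) (q := q) (τ := τ) hτ' (n + 1) ⟨le_rfl, hτ.le⟩
    rw [h, ← h0, ← this]
    congr 1; push_cast; ring

theorem loop_cases (hT : 0 < τ + τ') (t : ℝ) :
    ∃ n : ℤ, (∃ s ∈ Ico 0 τ, t = n * (τ + τ') + s) ∨ ∃ s ∈ Ico 0 τ', t = n * (τ + τ') + τ + s := by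
  have e := Int.floor_add_fract (t / (τ + τ'))
  have h0 := Int.fract_nonneg (t / (τ + τ'))
  have h1 := Int.fract_lt_one (t / (τ + τ'))
  have et : t = ⌊t / (τ + τ')⌋ * (τ + τ') + Int.fract (t / (τ + τ')) * (τ + τ') := by
    rw [← add_mul, e]; field_simp
  refine ⟨⌊t / (τ + τ')⌋, ?_⟩
  rcases lt_or_ge (Int.fract (t / (τ + τ')) * (τ + τ')) τ with h | h
  · exact Or.inl ⟨_, ⟨by positivity, h⟩, et⟩
  · refine Or.inr ⟨Int.fract (t / (τ + τ')) * (τ + τ') - τ, ⟨by linarith, ?_⟩, ?_⟩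
    · nlinarith
    · linarith

theorem range_loop (hτ : 0 < τ) (hτ' : 0 < τ') (h0 : p 0 = q τ') (h1 : p τ = q 0) :
    range (loop p q τ τ') = p '' Icc 0 τ ∪ q '' Icc 0 τ' := by
  ext P
  constructor
  · rintro ⟨t, rfl⟩
    obtain ⟨n, ⟨s, hs, rfl⟩ | ⟨s, hs, rfl⟩⟩ := loop_cases (add_pos hτ hτ') t
    · exact Or.inl ⟨s, Ico_subset_Icc_self hs, (loop_first hτ' n (Ico_subset_Icc_self hs)).symm⟩
    · exact Or.inr
        ⟨s, Ico_subset_Icc_self hs, (loop_second hτ hτ' h0 h1 n (Ico_subset_Icc_self hs)).symm⟩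
  · rintro (⟨s, hs, rfl⟩ | ⟨s, hs, rfl⟩)
    · exact ⟨_, loop_first hτ' 0 hs⟩
    · exact ⟨_, loop_second hτ hτ' h0 h1 0 hs⟩

theorem hasDerivWithinAt_Ici_of_eqOn {γ f : ℝ → ℝ × ℝ} {v : ℝ × ℝ} {c s b : ℝ}
    (hf : HasDerivAt f v s) (hb : s < b) (h : ∀ r ∈ Icc s b, γ (c + r) = f r) :
    HasDerivWithinAt γ v (Ici (c + s)) (c + s) := by
  have h1 : HasDerivAt (fun t => f (t - c)) v (c + s) := by
    refine HasDerivAt.comp_sub_const _ _ ?_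
    simpa using hf
  refine h1.hasDerivWithinAt.congr_of_eventuallyEq ?_ ?_
  · filter_upwards [Icc_mem_nhdsGE (show c + s < c + b by linarith)] with t ht
    rw [← h (t - c) ⟨by linarith [ht.1], by linarith [ht.2]⟩]
    congr 1; ring
  · simpa using h s ⟨le_rfl, hb.le⟩

theorem hasDerivWithinAt_Iic_of_eqOn {γ f : ℝ → ℝ × ℝ} {v : ℝ × ℝ} {c s b : ℝ}
    (hf : HasDerivAt f v s) (hb : b < s) (h : ∀ r ∈ Icc b s, γ (c + r) = f r) :
    HasDerivWithinAt γ v (Iic (c + s)) (c + s) := by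
  have h1 : HasDerivAt (fun t => f (t - c)) v (c + s) := by
    refine HasDerivAt.comp_sub_const _ _ ?_
    simpa using hf
  refine h1.hasDerivWithinAt.congr_of_eventuallyEq ?_ ?_
  · filter_upwards [Icc_mem_nhdsLE (show c + b < c + s by linarith)] with t ht
    rw [← h (t - c) ⟨by linarith [ht.1], by linarith [ht.2]⟩]
    congr 1; ring
  · simpa using h s ⟨hb.le, le_rfl⟩

theorem hasDerivAt_of_Iic_Ici {γ : ℝ → ℝ × ℝ} {v : ℝ × ℝ} {t : ℝ}
    (h1 : HasDerivWithinAt γ v (Iic t) t) (h2 : HasDerivWithinAt γ v (Ici t) t) :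
    HasDerivAt γ v t := by
  have := h1.union h2
  rwa [Iic_union_Ici, hasDerivWithinAt_univ] at this

end loop

/-- Data satisfying the bifurcation equations give a periodic orbit. -/
theorem isPeriodicOrbit_cycle {α β k y₀ y₁ : ℝ} (h : CycleData α β k y₀ y₁) :
    IsPeriodicOrbit (vf α β k) (cycle α β k y₀ y₁) := by
  set τ := rightTime y₀ y₁ with hτdef
  set τ' := leftTime α k y₀ y₁ with hτdef'
  have hτ : 0 < τ := rightTime_pos _ _
  have hτ' : 0 < τ' := h.leftTime_pos
  have j0 : rightArc β y₀ 0 = leftArc α k y₁ τ' := by rw [h.leftArc_end, rightArc_zero]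
  have j1 : rightArc β y₀ τ = leftArc α k y₁ 0 := by rw [h.rightArc_end, leftArc_zero]
  set γ := loop (rightArc β y₀) (leftArc α k y₁) τ τ' with hγ
  have f1 : ∀ (n : ℤ) {s : ℝ}, s ∈ Icc 0 τ → γ (n * (τ + τ') + s) = rightArc β y₀ s :=
    fun n s hs => loop_first hτ' n hs
  have f2 : ∀ (n : ℤ) {s : ℝ}, s ∈ Icc 0 τ' → γ (n * (τ + τ') + τ + s) = leftArc α k y₁ s :=
    fun n s hs => loop_second hτ hτ' j0 j1 n hs
  have r1 : ∀ (n : ℤ) {s : ℝ}, s ∈ Ico 0 τ → HasDerivWithinAt γ (vf α β k .C (rightArc β y₀ s))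
      (Ici (n * (τ + τ') + s)) (n * (τ + τ') + s) := fun n s hs =>
    hasDerivWithinAt_Ici_of_eqOn (hasDerivAt_rightArc α β k y₀ s) hs.2
      fun r hr => f1 n ⟨hs.1.trans hr.1, hr.2⟩
  have l1 : ∀ (n : ℤ) {s : ℝ}, s ∈ Ioc 0 τ → HasDerivWithinAt γ (vf α β k .C (rightArc β y₀ s))
      (Iic (n * (τ + τ') + s)) (n * (τ + τ') + s) := fun n s hs =>
    hasDerivWithinAt_Iic_of_eqOn (hasDerivAt_rightArc α β k y₀ s) hs.1
      fun r hr => f1 n ⟨hr.1, hr.2.trans hs.2⟩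
  have r2 : ∀ (n : ℤ) {s : ℝ}, s ∈ Ico 0 τ' → HasDerivWithinAt γ (vf α β k .L (leftArc α k y₁ s))
      (Ici (n * (τ + τ') + τ + s)) (n * (τ + τ') + τ + s) := fun n s hs =>
    hasDerivWithinAt_Ici_of_eqOn (hasDerivAt_leftArc α β k y₁ s) hs.2
      fun r hr => f2 n ⟨hs.1.trans hr.1, hr.2⟩
  have l2 : ∀ (n : ℤ) {s : ℝ}, s ∈ Ioc 0 τ' → HasDerivWithinAt γ (vf α β k .L (leftArc α k y₁ s))
      (Iic (n * (τ + τ') + τ + s)) (n * (τ + τ') + τ + s) := fun n s hs =>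
    hasDerivWithinAt_Iic_of_eqOn (hasDerivAt_leftArc α β k y₁ s) hs.1
      fun r hr => f2 n ⟨hr.1, hr.2.trans hs.2⟩
  refine ⟨γ, τ + τ', ?_, by positivity, loop_periodic (by positivity), ⟨τ, ?_⟩,
    (range_loop hτ hτ' j0 j1).symm⟩
  · intro t
    obtain ⟨n, ⟨s, hs, rfl⟩ | ⟨s, hs, rfl⟩⟩ := loop_cases (add_pos hτ hτ') t
    · have hval := f1 n (Ico_subset_Icc_self hs)
      rcases hs.1.eq_or_lt with h0 | h0
      · -- the rising crossing point `(-1, y₀)`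
        subst h0
        rw [rightArc_zero] at hval
        have hL := l2 (n - 1) ⟨hτ', le_rfl⟩
        rw [h.leftArc_end, show ((n - 1 : ℤ) : ℝ) * (τ + τ') + τ + τ' = n * (τ + τ') + 0 by
          push_cast; ring] at hL
        have hC := r1 n ⟨le_rfl, hτ⟩
        rw [rightArc_zero] at hC
        have pL : 0 < (vf α β k .L (-1, y₀)).1 := by simp only [vf]; linarith [h.left_up]
        have pC : 0 < (vf α β k .C (-1, y₀)).1 := by simp only [vf]; linarith [h.right_up]
        rw [CrossesAt, CrossesAt, hval]
        refine ⟨fun z hz => ?_, fun _ => ⟨by positivity, fun _ => ⟨hL, hC⟩, fun hn => ?_⟩,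
          fun h1 => ?_⟩
        · cases z <;> norm_num [Zone.region] at hz
        · linarith
        · norm_num at h1
      · have hd := hasDerivAt_of_Iic_Ici (l1 n ⟨h0, hs.2.le⟩) (r1 n hs)
        have hx := h.lt_rightArc ⟨h0, hs.2⟩
        rw [← hval] at hd hx
        refine ⟨fun z hz => ?_, fun h1 => ?_, fun h1 => ?_⟩
        · cases z
          · simp only [Zone.region, mem_ofPred_eq] at hz; linarith
          · exact hd
          · exact hd
        · linarith
        · have ht := h.rightArc_transverse hs.1 (hval ▸ h1)
          rw [← hval] at ht
          exact ⟨mul_self_pos.2 ht, fun _ => ⟨hd.hasDerivWithinAt, hd.hasDerivWithinAt⟩,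
            fun _ => ⟨hd.hasDerivWithinAt, hd.hasDerivWithinAt⟩⟩
    · have hval := f2 n (Ico_subset_Icc_self hs)
      rcases hs.1.eq_or_lt with h0 | h0
      · -- the falling crossing point `(-1, -y₁)`
        subst h0
        rw [leftArc_zero] at hval
        have hC := l1 n ⟨hτ, le_rfl⟩
        rw [h.rightArc_end, ← add_zero (_ + τ)] at hC
        have hL := r2 n ⟨le_rfl, hτ'⟩
        rw [leftArc_zero] at hL
        have pL : (vf α β k .L (-1, -y₁)).1 < 0 := by simp only [vf]; linarith [h.left_down]
        have pC : (vf α β k .C (-1, -y₁)).1 < 0 := by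
          simp only [vf]; linarith [h.nonneg, h.pos₁]
        rw [CrossesAt, CrossesAt, hval]
        refine ⟨fun z hz => ?_, fun _ => ⟨mul_pos_of_neg_of_neg pL pC, fun hn => ?_,
          fun _ => ⟨hC, hL⟩⟩, fun h1 => ?_⟩
        · cases z <;> norm_num [Zone.region] at hz
        · linarith
        · norm_num at h1
      · have hd := hasDerivAt_of_Iic_Ici (l2 n ⟨h0, hs.2.le⟩) (r2 n hs)
        have hx := h.leftArc_lt ⟨h0, hs.2⟩
        rw [← hval] at hd hx
        refine ⟨fun z hz => ?_, fun h1 => ?_, fun h1 => ?_⟩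
        · cases z
          · exact hd
          · simp only [Zone.region, mem_ofPred_eq] at hz; linarith [hz.1]
          · simp only [Zone.region, mem_ofPred_eq] at hz; linarith
        · linarith
        · linarith
  · have e0 : γ 0 = (-1, y₀) := by
      have := f1 0 (s := 0) ⟨le_rfl, hτ.le⟩
      rwa [rightArc_zero, Int.cast_zero, zero_mul, zero_add] at this
    have e1 : γ τ = (-1, -y₁) := by
      have := f1 0 (s := τ) ⟨hτ.le, le_rfl⟩
      rwa [h.rightArc_end, Int.cast_zero, zero_mul, zero_add] at this
    rw [e0, e1]
    intro hc
    have := congrArg Prod.snd hc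
    simp only at this
    linarith [h.pos₀, h.pos₁]

/-! ### Crossings of the line `x = -1` -/

theorem eventually_slope_pos {f : ℝ → ℝ} {f' t : ℝ} {s : Set ℝ} (h : HasDerivWithinAt f f' s t)
    (hf : 0 < f') : ∀ᶠ r in 𝓝[s \ {t}] t, 0 < (r - t) * (f r - f t) := by
  have h1 := hasDerivWithinAt_iff_tendsto_slope.1 h
  filter_upwards [h1.eventually (lt_mem_nhds hf), self_mem_nhdsWithin] with r hr hrs
  have hne : r - t ≠ 0 := sub_ne_zero.2 hrs.2
  rw [slope_def_field] at hr
  have : (r - t) * (f r - f t) = (f r - f t) / (r - t) * (r - t) ^ 2 := by field_simp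
  rw [this]
  positivity

theorem eventually_lt_right {f : ℝ → ℝ} {f' t : ℝ} (h : HasDerivWithinAt f f' (Ici t) t)
    (hf : 0 < f') : ∀ᶠ r in 𝓝[>] t, f t < f r := by
  have := eventually_slope_pos h hf
  rw [Ici_sdiff_left] at this
  filter_upwards [this, self_mem_nhdsWithin] with r hr hrt
  have := pos_of_mul_pos_right hr (sub_nonneg.2 (mem_Ioi.1 hrt).le)
  linarith

theorem eventually_lt_left {f : ℝ → ℝ} {f' t : ℝ} (h : HasDerivWithinAt f f' (Iic t) t)
    (hf : 0 < f') : ∀ᶠ r in 𝓝[<] t, f r < f t := by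
  have := eventually_slope_pos h hf
  rw [Iic_sdiff_right] at this
  filter_upwards [this, self_mem_nhdsWithin] with r hr hrt
  have := mem_Iio.1 hrt
  nlinarith

/-- The first element of a closed set at or after `t`. -/
theorem exists_first {Z : Set ℝ} (hZ : IsClosed Z) {t b : ℝ} (htb : t ≤ b) (hb : b ∈ Z) :
    ∃ c ∈ Z, t ≤ c ∧ ∀ s, t ≤ s → s < c → s ∉ Z := by
  have hK : IsCompact (Icc t b ∩ Z) := isCompact_Icc.inter_right hZ
  obtain ⟨c, hc, hmin⟩ := hK.exists_isLeast ⟨b, ⟨htb, le_rfl⟩, hb⟩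
  exact ⟨c, hc.2, hc.1.1, fun s h1 h2 hs => (hmin ⟨⟨h1, h2.le.trans hc.1.2⟩, hs⟩).not_gt h2⟩

/-- The last element of a closed set at or before `t`. -/
theorem exists_last {Z : Set ℝ} (hZ : IsClosed Z) {t b : ℝ} (htb : b ≤ t) (hb : b ∈ Z) :
    ∃ c ∈ Z, c ≤ t ∧ ∀ s, c < s → s ≤ t → s ∉ Z := by
  have hK : IsCompact (Icc b t ∩ Z) := isCompact_Icc.inter_right hZ
  obtain ⟨c, hc, hmax⟩ := hK.exists_isGreatest ⟨b, ⟨le_rfl, htb⟩, hb⟩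
  exact ⟨c, hc.2, hc.1.2, fun s h1 h2 hs => (hmax ⟨⟨hc.1.1.trans h1.le, h2⟩, hs⟩).not_gt h1⟩

theorem CrossesAt.continuousAt {X Y : ℝ × ℝ → ℝ × ℝ} {γ : ℝ → ℝ × ℝ} {t : ℝ}
    (h : CrossesAt X Y γ t) : ContinuousAt γ t := by
  rw [continuousAt_iff_continuous_left_right]
  rcases pos_and_pos_or_neg_and_neg_of_mul_pos h.1 with h1 | h1
  · exact ⟨(h.2.1 h1.1).1.continuousWithinAt, (h.2.1 h1.1).2.continuousWithinAt⟩
  · exact ⟨(h.2.2 h1.1).1.continuousWithinAt, (h.2.2 h1.1).2.continuousWithinAt⟩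

theorem IsCrossingSolution.continuous {X : Zone → ℝ × ℝ → ℝ × ℝ} {γ : ℝ → ℝ × ℝ}
    (h : IsCrossingSolution X γ) : Continuous γ := by
  refine continuous_iff_continuousAt.2 fun t => ?_
  obtain ⟨h1, h2, h3⟩ := h t
  rcases lt_trichotomy (γ t).1 (-1) with hx | hx | hx
  · exact (h1 .L hx).continuousAt
  · exact (h2 hx).continuousAt
  rcases lt_trichotomy (γ t).1 1 with hx' | hx' | hx'
  · exact (h1 .C ⟨hx, hx'⟩).continuousAt
  · exact (h3 hx').continuousAt
  · exact (h1 .R hx').continuousAt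

/-- `γ` crosses the line `x = -1` from left to right at time `t`. The two inequalities say that both
adjacent fields point to the right. -/
def RisesAt (α β k : ℝ) (γ : ℝ → ℝ × ℝ) (t : ℝ) : Prop :=
  (γ t).1 = -1 ∧ β < (γ t).2 ∧ 2 * α + k < (γ t).2 ∧
    (∀ᶠ s in 𝓝[<] t, (γ s).1 < -1) ∧ ∀ᶠ s in 𝓝[>] t, -1 < (γ s).1

/-- `γ` crosses the line `x = -1` from right to left at time `t`. The two inequalities say that both
adjacent fields point to the left. -/
def FallsAt (α β k : ℝ) (γ : ℝ → ℝ × ℝ) (t : ℝ) : Prop :=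
  (γ t).1 = -1 ∧ (γ t).2 < β ∧ (γ t).2 < 2 * α + k ∧
    (∀ᶠ s in 𝓝[<] t, -1 < (γ s).1) ∧ ∀ᶠ s in 𝓝[>] t, (γ s).1 < -1

section solution

variable {α β k T : ℝ} {γ : ℝ → ℝ × ℝ}

theorem hasDerivAt_of_lt (h : IsCrossingSolution (vf α β k) γ) {t : ℝ} (ht : -1 < (γ t).1) :
    HasDerivAt γ (vf α β k .C (γ t)) t := by
  obtain ⟨h1, -, h3⟩ := h t
  rcases lt_trichotomy (γ t).1 1 with hx | hx | hx
  · exact h1 .C ⟨ht, hx⟩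
  · have hc := h3 hx
    rcases pos_and_pos_or_neg_and_neg_of_mul_pos hc.1 with h4 | h4
    · exact hasDerivAt_of_Iic_Ici (hc.2.1 h4.1).1 (hc.2.1 h4.1).2
    · exact hasDerivAt_of_Iic_Ici (hc.2.2 h4.1).1 (hc.2.2 h4.1).2
  · exact h1 .R hx

theorem risesAt_or_fallsAt (h : IsCrossingSolution (vf α β k) γ) {t : ℝ} (ht : (γ t).1 = -1) :
    RisesAt α β k γ t ∨ FallsAt α β k γ t := by
  have hc := (h t).2.1 ht
  have eL : (vf α β k .L (γ t)).1 = 2 * ((γ t).2 - (2 * α + k)) := by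
    simp only [vf, ht]; ring
  have eC : (vf α β k .C (γ t)).1 = (γ t).2 - β := by
    simp only [vf, ht]; ring
  have hfst : ∀ {v : ℝ × ℝ} {s : Set ℝ}, HasDerivWithinAt γ v s t →
      HasDerivWithinAt (fun s => (γ s).1) v.1 s t := fun hd =>
    hd.hasFDerivWithinAt.fst.hasDerivWithinAt.congr_deriv (by simp)
  rcases pos_and_pos_or_neg_and_neg_of_mul_pos hc.1 with h4 | h4
  · left
    obtain ⟨hl, hr⟩ := hc.2.1 h4.1
    refine ⟨ht, by linarith [h4.2], by linarith [h4.1], ?_, ?_⟩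
    · simpa only [ht] using eventually_lt_left (hfst hl) h4.1
    · simpa only [ht] using eventually_lt_right (hfst hr) h4.2
  · right
    obtain ⟨hl, hr⟩ := hc.2.2 h4.1
    refine ⟨ht, by linarith [h4.2], by linarith [h4.1], ?_, ?_⟩
    · filter_upwards [eventually_lt_left (hfst hl).neg (neg_pos.2 h4.2)] with s hs
      simp only [Pi.neg_apply] at hs
      linarith
    · filter_upwards [eventually_lt_right (hfst hr).neg (neg_pos.2 h4.1)] with s hs
      simp only [Pi.neg_apply] at hs
      linarith

theorem isClosed_crossing (h : IsCrossingSolution (vf α β k) γ) :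
    IsClosed {t | (γ t).1 = -1} :=
  isClosed_eq (continuous_fst.comp h.continuous) continuous_const

theorem exists_next (h : IsCrossingSolution (vf α β k) γ) (hT : 0 < T)
    (hper : Function.Periodic γ T) {t : ℝ} (ht : (γ t).1 = -1) :
    ∃ t₂, t < t₂ ∧ (γ t₂).1 = -1 ∧ ∀ s ∈ Ioo t t₂, (γ s).1 ≠ -1 := by
  have hev : ∀ᶠ s in 𝓝[>] t, (γ s).1 ≠ -1 := by
    rcases risesAt_or_fallsAt h ht with h1 | h1
    · filter_upwards [h1.2.2.2.2] with s hs using hs.ne'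
    · filter_upwards [h1.2.2.2.2] with s hs using hs.ne
  obtain ⟨b, hb, hbs⟩ := mem_nhdsGT_iff_exists_Ioc_subset.1 hev
  have hbT : b ≤ t + T := by
    by_contra! hlt
    exact hbs ⟨by linarith, hlt.le⟩ (by rw [hper t, ht])
  obtain ⟨c, hc, hbc, hfirst⟩ := exists_first (isClosed_crossing h) hbT
    (show (γ (t + T)).1 = -1 by rw [hper t, ht])
  refine ⟨c, lt_of_lt_of_le hb hbc, hc, fun s hs => ?_⟩
  rcases le_total s b with h1 | h1
  · exact hbs ⟨hs.1, h1⟩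
  · exact hfirst s h1 hs.2

theorem exists_prev (h : IsCrossingSolution (vf α β k) γ) (hT : 0 < T)
    (hper : Function.Periodic γ T) {t : ℝ} (ht : (γ t).1 = -1) :
    ∃ t₁, t₁ < t ∧ (γ t₁).1 = -1 ∧ ∀ s ∈ Ioo t₁ t, (γ s).1 ≠ -1 := by
  have hev : ∀ᶠ s in 𝓝[<] t, (γ s).1 ≠ -1 := by
    rcases risesAt_or_fallsAt h ht with h1 | h1
    · filter_upwards [h1.2.2.2.1] with s hs using hs.ne
    · filter_upwards [h1.2.2.2.1] with s hs using hs.ne'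
  obtain ⟨b, hb, hbs⟩ := mem_nhdsLT_iff_exists_Ico_subset.1 hev
  have hbT : t - T ≤ b := by
    by_contra! hlt
    exact hbs ⟨hlt.le, by linarith⟩ (by rw [hper.sub_eq, ht])
  obtain ⟨c, hc, hbc, hlast⟩ := exists_last (isClosed_crossing h) hbT
    (show (γ (t - T)).1 = -1 by rw [hper.sub_eq, ht])
  refine ⟨c, lt_of_le_of_lt hbc hb, hc, fun s hs => ?_⟩
  rcases le_total s b with h1 | h1
  · exact hlast s hs.1 h1
  · exact hbs ⟨h1, hs.2⟩

/-- Between consecutive crossing times the solution makes an excursion to one side. -/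
theorem excursion_cases (h : IsCrossingSolution (vf α β k) γ) {t₁ t₂ : ℝ} (hlt : t₁ < t₂)
    (h1 : (γ t₁).1 = -1) (h2 : (γ t₂).1 = -1) (hne : ∀ s ∈ Ioo t₁ t₂, (γ s).1 ≠ -1) :
    (RisesAt α β k γ t₁ ∧ FallsAt α β k γ t₂ ∧ ∀ s ∈ Ioo t₁ t₂, -1 < (γ s).1) ∨
      (FallsAt α β k γ t₁ ∧ RisesAt α β k γ t₂ ∧ ∀ s ∈ Ioo t₁ t₂, (γ s).1 < -1) := by
  have hcont : ContinuousOn (fun s => (γ s).1) (Ioo t₁ t₂) :=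
    (continuous_fst.comp h.continuous).continuousOn
  have e1 : ∀ᶠ s in 𝓝[>] t₁, s ∈ Ioo t₁ t₂ := Ioo_mem_nhdsGT hlt
  have e2 : ∀ᶠ s in 𝓝[<] t₂, s ∈ Ioo t₁ t₂ := Ioo_mem_nhdsLT hlt
  by_cases hall : ∀ s ∈ Ioo t₁ t₂, -1 < (γ s).1
  · refine Or.inl ⟨(risesAt_or_fallsAt h h1).resolve_right fun hf => ?_,
      (risesAt_or_fallsAt h h2).resolve_left fun hf => ?_, hall⟩
    · obtain ⟨s, hs, hs'⟩ := (e1.and hf.2.2.2.2).exists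
      linarith [hall s hs]
    · obtain ⟨s, hs, hs'⟩ := (e2.and hf.2.2.2.1).exists
      linarith [hall s hs]
  · push Not at hall
    obtain ⟨r, hr, hr'⟩ := hall
    have hall' : ∀ s ∈ Ioo t₁ t₂, (γ s).1 < -1 := by
      intro s hs
      by_contra! hs'
      obtain ⟨c, hc, hc'⟩ := isPreconnected_Ioo.intermediate_value hr hs hcont ⟨hr', hs'⟩
      exact hne c hc hc'
    refine Or.inr ⟨(risesAt_or_fallsAt h h1).resolve_left fun hf => ?_,
      (risesAt_or_fallsAt h h2).resolve_right fun hf => ?_, hall'⟩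
    · obtain ⟨s, hs, hs'⟩ := (e1.and hf.2.2.2.2).exists
      linarith [hall' s hs]
    · obtain ⟨s, hs, hs'⟩ := (e2.and hf.2.2.2.1).exists
      linarith [hall' s hs]

theorem fst_snd_hasDerivAt {γ : ℝ → ℝ × ℝ} {v : ℝ × ℝ} {t : ℝ} (h : HasDerivAt γ v t) :
    HasDerivAt (fun s => (γ s).1) v.1 t ∧ HasDerivAt (fun s => (γ s).2) v.2 t :=
  ⟨h.hasFDerivAt.fst.hasDerivAt.congr_deriv (by simp),
    h.hasFDerivAt.snd.hasDerivAt.congr_deriv (by simp)⟩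

theorem right_spiral (h : IsCrossingSolution (vf α β k) γ) {t₁ t₂ : ℝ}
    (hin : ∀ s ∈ Ioo t₁ t₂, -1 < (γ s).1) {t : ℝ} (ht : t ∈ Icc t₁ t₂) :
    (γ t).2 = spiralU β (γ t₁).2 (-(γ t₁).1) (t - t₁) ∧
      -(γ t).1 = spiralV β (γ t₁).2 (-(γ t₁).1) (t - t₁) := by
  refine eq_spiral (u := fun s => (γ s).2) (v := fun s => -(γ s).1)
    (continuous_snd.comp h.continuous).continuousOn
    (continuous_fst.comp h.continuous).neg.continuousOn (fun s hs => ?_) (fun s hs => ?_) ht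
  · refine (fst_snd_hasDerivAt (hasDerivAt_of_lt h (hin s hs))).2.congr_deriv ?_
    simp only [vf]; ring
  · refine (fst_snd_hasDerivAt (hasDerivAt_of_lt h (hin s hs))).1.neg.congr_deriv ?_
    simp only [vf]; ring

theorem left_spiral (h : IsCrossingSolution (vf α β k) γ) {t₁ t₂ : ℝ}
    (hin : ∀ s ∈ Ioo t₁ t₂, (γ s).1 < -1) {t : ℝ} (ht : t ∈ Icc t₁ t₂) :
    ((γ t).1 + 2 * (γ t).2 + 1) / 2 - leftShift α k =
        spiralU α (((γ t₁).1 + 2 * (γ t₁).2 + 1) / 2 - leftShift α k)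
          (leftDist α k - ((γ t₁).1 + 1) / 2) (t - t₁) ∧
      leftDist α k - ((γ t).1 + 1) / 2 =
        spiralV α (((γ t₁).1 + 2 * (γ t₁).2 + 1) / 2 - leftShift α k)
          (leftDist α k - ((γ t₁).1 + 1) / 2) (t - t₁) := by
  have hc := h.continuous
  have e := mul_leftDist_add α k
  have e' := leftDist_eq α k
  refine eq_spiral (u := fun s => ((γ s).1 + 2 * (γ s).2 + 1) / 2 - leftShift α k)
    (v := fun s => leftDist α k - ((γ s).1 + 1) / 2) (by fun_prop) (by fun_prop)
    (fun s hs => ?_) (fun s hs => ?_) ht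
  · obtain ⟨hx, hy⟩ := fst_snd_hasDerivAt ((h s).1 .L (hin s hs))
    refine ((((hx.add (hy.const_mul 2)).add_const 1).div_const 2).sub_const
      (leftShift α k)).congr_deriv ?_
    simp only [vf]
    linear_combination -e'
  · obtain ⟨hx, hy⟩ := fst_snd_hasDerivAt ((h s).1 .L (hin s hs))
    refine (((hx.add_const 1).div_const 2).const_sub (leftDist α k)).congr_deriv ?_
    simp only [vf]
    linear_combination -e

/-- A solution that rises at `t₁` and falls at `t₂` below the `x`-axis, with no crossing in between,
runs through the right arc, and the crossing heights satisfy the right half return equation. -/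
theorem right_excursion (h : IsCrossingSolution (vf α β k) γ) (hβ : 0 < β) {t₁ t₂ : ℝ}
    (hlt : t₁ < t₂) (h1 : RisesAt α β k γ t₁) (h2 : FallsAt α β k γ t₂) (hneg : (γ t₂).2 < 0)
    (hin : ∀ s ∈ Ioo t₁ t₂, -1 < (γ s).1) :
    t₂ - t₁ = rightTime (γ t₁).2 (-(γ t₂).2) ∧ RightRel β (γ t₁).2 (-(γ t₂).2) ∧
      ∀ t ∈ Icc t₁ t₂, γ t = rightArc β (γ t₁).2 (t - t₁) := by
  have hs : ∀ t ∈ Icc t₁ t₂, (γ t).2 = spiralU β (γ t₁).2 1 (t - t₁) ∧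
      -(γ t).1 = spiralV β (γ t₁).2 1 (t - t₁) := fun t ht => by
    have := right_spiral h hin ht
    rwa [h1.1, neg_neg] at this
  obtain ⟨hU, hV⟩ := hs t₂ (right_mem_Icc.2 hlt.le)
  rw [h2.1, neg_neg] at hV
  have ht : t₂ - t₁ = rightTime (γ t₁).2 (-(γ t₂).2) := by
    rw [rightTime_eq, neg_neg, hU]
    refine time_of_long_excursion hβ one_pos (sub_pos.2 hlt) (hβ.trans h1.2.1) (fun s hs' => ?_)
      hV.symm (hU ▸ hneg)
    have := (hs (t₁ + s) ⟨by linarith [hs'.1], by linarith [hs'.2]⟩).2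
    rw [add_sub_cancel_left] at this
    rw [← this]
    linarith [hin (t₁ + s) ⟨by linarith [hs'.1], by linarith [hs'.2]⟩]
  refine ⟨ht, ?_, fun t ht => ?_⟩
  · have := spiral_sq β (γ t₁).2 1 (t₂ - t₁)
    rw [← hU, ← hV, ht] at this
    rw [RightRel, neg_sq]
    simpa using this
  · obtain ⟨h3, h4⟩ := hs t ht
    rw [rightArc, ← h3, ← h4, neg_neg]

/-- The counterpart of `right_excursion` for the zone `x < -1`. -/
theorem left_excursion (h : IsCrossingSolution (vf α β k) γ) (hd : 0 < leftDist α k) {t₁ t₂ : ℝ}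
    (hlt : t₁ < t₂) (h1 : (γ t₁).1 = -1) (h2 : (γ t₂).1 = -1)
    (hin : ∀ s ∈ Ioo t₁ t₂, (γ s).1 < -1) :
    t₂ - t₁ = leftTime α k (γ t₂).2 (-(γ t₁).2) ∧ LeftRel α k (γ t₂).2 (-(γ t₁).2) ∧
      ∀ t ∈ Icc t₁ t₂, γ t = leftArc α k (-(γ t₁).2) (t - t₁) := by
  have e1 : ((γ t₁).1 + 2 * (γ t₁).2 + 1) / 2 - leftShift α k =
      -(-(γ t₁).2 + leftShift α k) := by rw [h1]; ring
  have e2 : leftDist α k - ((γ t₁).1 + 1) / 2 = leftDist α k := by rw [h1]; ring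
  have hs := fun t (ht : t ∈ Icc t₁ t₂) => left_spiral h hin ht
  simp only [e1, e2] at hs
  obtain ⟨hU, hV⟩ := hs t₂ (right_mem_Icc.2 hlt.le)
  rw [show ((γ t₂).1 + 2 * (γ t₂).2 + 1) / 2 = (γ t₂).2 by rw [h2]; ring] at hU
  rw [show leftDist α k - ((γ t₂).1 + 1) / 2 = leftDist α k by rw [h2]; ring] at hV
  have ht : t₂ - t₁ = leftTime α k (γ t₂).2 (-(γ t₁).2) := by
    rw [leftTime_eq, hU]
    refine time_of_short_excursion hd (sub_pos.2 hlt) (fun s hs' => ?_) hV.symm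
    have := (hs (t₁ + s) ⟨by linarith [hs'.1], by linarith [hs'.2]⟩).2
    rw [add_sub_cancel_left] at this
    rw [← this]
    linarith [hin (t₁ + s) ⟨by linarith [hs'.1], by linarith [hs'.2]⟩]
  refine ⟨ht, ?_, fun t ht => ?_⟩
  · have := spiral_sq α (-(-(γ t₁).2 + leftShift α k)) (leftDist α k) (t₂ - t₁)
    rw [← hU, ← hV, ht, neg_sq] at this
    exact this
  · obtain ⟨h3, h4⟩ := hs t ht
    rw [leftArc, ← h3, ← h4]
    ext <;> ring

theorem norm_sq_zero_of_spiral {c t u v : ℝ} (hc : c * t ≠ 0) (hu : u = spiralU c u v t)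
    (hv : v = spiralV c u v t) : u = 0 ∧ v = 0 := by
  have h := spiral_sq c u v t
  rw [← hu, ← hv] at h
  have he : Real.exp (2 * c * t) ≠ 1 := by
    rw [Ne, Real.exp_eq_one_iff, mul_assoc]
    exact mul_ne_zero two_ne_zero hc
  have h0 : v ^ 2 + u ^ 2 = 0 := by
    have : (Real.exp (2 * c * t) - 1) * (v ^ 2 + u ^ 2) = 0 := by linarith
    exact (mul_eq_zero.1 this).resolve_left (sub_ne_zero.2 he)
  constructor <;> nlinarith [sq_nonneg u, sq_nonneg v]

/-- A nonconstant periodic solution meets the line `x = -1`, because a spiral has no closed orbit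
around its focus. -/
theorem exists_crossing (h : IsCrossingSolution (vf α β k) γ) (hα : α ≠ 0) (hβ : β ≠ 0)
    (hT : 0 < T) (hper : Function.Periodic γ T) (hne : ∃ t, γ t ≠ γ 0) :
    ∃ t, (γ t).1 = -1 := by
  by_contra! hno
  obtain ⟨t, ht⟩ := hne
  have hcont : Continuous fun s => (γ s).1 := continuous_fst.comp h.continuous
  rcases lt_or_gt_of_ne (hno 0) with h0 | h0
  · have hall : ∀ s, (γ s).1 < -1 := by
      intro s
      by_contra! hs
      obtain ⟨c, hc⟩ := mem_range_of_exists_le_of_exists_ge hcont ⟨0, h0.le⟩ ⟨s, hs⟩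
      exact hno c hc
    have hconst : ∀ s, γ s = (2 * leftDist α k - 1, leftShift α k - leftDist α k) := by
      intro s
      have := left_spiral h (t₁ := s) (t₂ := s + T) (fun r _ => hall r)
        (right_mem_Icc.2 (by linarith))
      rw [hper s, add_sub_cancel_left] at this
      have := norm_sq_zero_of_spiral (mul_ne_zero hα hT.ne') this.1 this.2
      ext <;> linarith [this.1, this.2]
    exact ht (by rw [hconst, hconst 0])
  · have hall : ∀ s, -1 < (γ s).1 := by
      intro s
      by_contra! hs
      obtain ⟨c, hc⟩ := mem_range_of_exists_le_of_exists_ge hcont ⟨s, hs⟩ ⟨0, h0.le⟩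
      exact hno c hc
    have hconst : ∀ s, γ s = (0, 0) := by
      intro s
      have := right_spiral h (t₁ := s) (t₂ := s + T) (fun r _ => hall r)
        (right_mem_Icc.2 (by linarith))
      rw [hper s, add_sub_cancel_left] at this
      have := norm_sq_zero_of_spiral (mul_ne_zero hβ hT.ne') this.1 this.2
      ext <;> linarith [this.1, this.2]
    exact ht (by rw [hconst, hconst 0])

end solution

/-! ### Monotonicity of the half return maps -/

theorem strictMonoOn_halfReturn (c : ℝ) {d : ℝ} (hd : 0 < d) :
    StrictMonoOn (fun y => (d ^ 2 + y ^ 2) * Real.exp (2 * c * Real.arctan (y / d)))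
      (Ici (-(c * d))) := by
  have hder : ∀ y : ℝ, HasDerivAt
      (fun y => (d ^ 2 + y ^ 2) * Real.exp (2 * c * Real.arctan (y / d)))
      (2 * (y + c * d) * Real.exp (2 * c * Real.arctan (y / d))) y := by
    intro y
    have h1 : HasDerivAt (fun y : ℝ => d ^ 2 + y ^ 2) (2 * y) y := by
      simpa using (hasDerivAt_pow 2 y).const_add (d ^ 2)
    have h2 := ((((hasDerivAt_id y).div_const d).arctan).const_mul (2 * c)).exp
    refine (h1.mul h2).congr_deriv ?_
    simp only [id]
    have : d ^ 2 + y ^ 2 ≠ 0 := by positivity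
    field_simp
  refine strictMonoOn_of_deriv_pos (convex_Ici _)
    (continuous_iff_continuousAt.2 fun y => (hder y).continuousAt).continuousOn fun y hy => ?_
  rw [interior_Ici] at hy
  rw [(hder y).deriv]
  have : 0 < y + c * d := by linarith [mem_Ioi.1 hy]
  positivity

theorem rightRel_iff {β y₀ y₁ : ℝ} : RightRel β y₀ y₁ ↔
    (1 ^ 2 + y₁ ^ 2) * Real.exp (2 * β * Real.arctan (y₁ / 1)) = Real.exp (4 * Real.pi * β) *
      ((1 ^ 2 + y₀ ^ 2) * Real.exp (2 * (-β) * Real.arctan (y₀ / 1))) := by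
  have e : Real.exp (2 * β * rightTime y₀ y₁) * Real.exp (2 * β * Real.arctan (y₁ / 1)) =
      Real.exp (4 * Real.pi * β) * Real.exp (2 * (-β) * Real.arctan (y₀ / 1)) := by
    rw [← Real.exp_add, ← Real.exp_add]; congr 1; simp only [rightTime, div_one]; ring
  rw [RightRel, one_pow]
  constructor
  · intro h
    rw [h]
    linear_combination (1 + y₀ ^ 2) * e
  · intro h
    refine mul_right_cancel₀ (Real.exp_pos (2 * β * Real.arctan (y₁ / 1))).ne' ?_
    rw [h]
    linear_combination -(1 + y₀ ^ 2) * e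

theorem leftRel_iff {α k y₀ y₁ : ℝ} : LeftRel α k y₀ y₁ ↔
    (leftDist α k ^ 2 + (y₀ - leftShift α k) ^ 2) *
        Real.exp (2 * (-α) * Real.arctan ((y₀ - leftShift α k) / leftDist α k)) =
      (leftDist α k ^ 2 + (y₁ + leftShift α k) ^ 2) *
        Real.exp (2 * α * Real.arctan ((y₁ + leftShift α k) / leftDist α k)) := by
  have e : Real.exp (2 * α * leftTime α k y₀ y₁) *
      Real.exp (2 * (-α) * Real.arctan ((y₀ - leftShift α k) / leftDist α k)) =
      Real.exp (2 * α * Real.arctan ((y₁ + leftShift α k) / leftDist α k)) := by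
    rw [← Real.exp_add]; congr 1; simp only [leftTime]; ring
  rw [LeftRel, ← e]
  constructor
  · intro h
    rw [h]; ring
  · intro h
    refine mul_right_cancel₀ (Real.exp_pos
      (2 * (-α) * Real.arctan ((y₀ - leftShift α k) / leftDist α k))).ne' ?_
    rw [h]; ring

theorem RightRel.le {β y₀ y₁ y₀' y₁' : ℝ} (h : RightRel β y₀ y₁) (h' : RightRel β y₀' y₁')
    (h0 : β ≤ y₀) (h1 : -β ≤ y₁) (h1' : -β ≤ y₁') (hle : y₀ ≤ y₀') : y₁ ≤ y₁' := by
  rw [rightRel_iff] at h h'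
  refine ((strictMonoOn_halfReturn β one_pos).le_iff_le ?_ ?_).1 ?_
  · simpa using h1
  · simpa using h1'
  · rw [h, h']
    refine mul_le_mul_of_nonneg_left ?_ (Real.exp_pos _).le
    refine (strictMonoOn_halfReturn (-β) one_pos).monotoneOn ?_ ?_ hle
    · simpa using h0
    · simpa using h0.trans hle

theorem LeftRel.le {α k y₀ y₁ y₀' y₁' : ℝ} (hd : 0 < leftDist α k) (h : LeftRel α k y₀ y₁)
    (h' : LeftRel α k y₀' y₁') (h0 : 2 * α + k ≤ y₀) (h0' : 2 * α + k ≤ y₀')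
    (h1 : -(2 * α + k) ≤ y₁) (hle : y₁ ≤ y₁') : y₀ ≤ y₀' := by
  have e := mul_leftDist_add α k
  rw [leftRel_iff] at h h'
  have := ((strictMonoOn_halfReturn (-α) hd).le_iff_le (a := y₀ - leftShift α k)
    (b := y₀' - leftShift α k) (mem_Ici.2 (by linarith)) (mem_Ici.2 (by linarith))).1 ?_
  · linarith
  · rw [h, h']
    exact (strictMonoOn_halfReturn α hd).monotoneOn (mem_Ici.2 (by linarith))
      (mem_Ici.2 (by linarith)) (by linarith)

/-! ### Isolation of the periodic orbits -/

theorem cycle_crossing {α β k y₀ y₁ : ℝ} (h : CycleData α β k y₀ y₁) {P : ℝ × ℝ}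
    (hP : P ∈ cycle α β k y₀ y₁) (hx : P.1 = -1) : P = (-1, y₀) ∨ P = (-1, -y₁) := by
  rcases hP with ⟨t, ht, rfl⟩ | ⟨t, ht, rfl⟩
  · rcases ht.1.eq_or_lt with h0 | h0
    · rw [← h0, rightArc_zero]; exact Or.inl rfl
    rcases ht.2.eq_or_lt with h1 | h1
    · rw [h1, h.rightArc_end]; exact Or.inr rfl
    · exact absurd hx (h.lt_rightArc ⟨h0, h1⟩).ne'
  · rcases ht.1.eq_or_lt with h0 | h0
    · rw [← h0, leftArc_zero]; exact Or.inr rfl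
    rcases ht.2.eq_or_lt with h1 | h1
    · rw [h1, h.leftArc_end]; exact Or.inl rfl
    · exact absurd hx (h.leftArc_lt ⟨h0, h1⟩).ne

theorem up_mem_cycle (α β k y₀ y₁ : ℝ) : (-1, y₀) ∈ cycle α β k y₀ y₁ :=
  Or.inl ⟨0, ⟨le_rfl, (rightTime_pos _ _).le⟩, rightArc_zero _ _⟩

/-- The return map to the rising crossings is increasing and has no other fixed point near `y₀`.
So the highest and the lowest rising crossing of a nearby periodic orbit, each of which has a
predecessor and a successor on the orbit, are fixed points and hence equal to `y₀`. -/
theorem isLimitCycle_cycle {α β k y₀ y₁ : ℝ} (h : CycleData α β k y₀ y₁) (hα : α ≠ 0) (hβ : 0 < β)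
    (hiso : ∀ᶠ q in 𝓝 (y₀, y₁), RightRel β q.1 q.2 → LeftRel α k q.1 q.2 → q = (y₀, y₁)) :
    IsLimitCycle (vf α β k) (cycle α β k y₀ y₁) := by
  refine ⟨isPeriodicOrbit_cycle h, ?_⟩
  obtain ⟨r₀, hr₀, hiso⟩ := Metric.eventually_nhds_iff.1 hiso
  obtain ⟨r, hr, hrr, hry₁, hry₀⟩ : ∃ r > 0, r ≤ r₀ ∧ r ≤ y₁ ∧ r ≤ y₀ - β :=
    ⟨min r₀ (min y₁ (y₀ - β)), by simp [hr₀, h.pos₁, h.right_up], min_le_left _ _,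
      (min_le_right _ _).trans (min_le_left _ _), (min_le_right _ _).trans (min_le_right _ _)⟩
  refine ⟨{P | P.1 = -1 → |P.2 - y₀| < r ∨ |P.2 + y₁| < r}, ?_, ?_, ?_⟩
  · have hcl : IsClosed {P : ℝ × ℝ | P.1 = -1 ∧ r ≤ |P.2 - y₀| ∧ r ≤ |P.2 + y₁|} :=
      (isClosed_eq continuous_fst continuous_const).inter
        ((isClosed_le continuous_const (continuous_snd.sub continuous_const).abs).inter
          (isClosed_le continuous_const (continuous_snd.add continuous_const).abs))
    convert hcl.isOpen_compl using 1
    ext P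
    simp only [mem_ofPred_eq, mem_compl_iff, not_and, not_le]
    constructor
    · intro h1 h2 h3
      exact (h1 h2).resolve_left (not_lt.2 h3)
    · intro h1 h2
      rcases lt_or_ge |P.2 - y₀| r with h3 | h3
      · exact Or.inl h3
      · exact Or.inr (h1 h2 h3)
  · intro P hP hx
    rcases cycle_crossing h hP hx with rfl | rfl
    · left; simpa using hr
    · right; simpa using hr
  rintro _ ⟨γ, T, hsol, hT, hper, hne, rfl⟩ hU
  have hβ0 := h.nonneg
  have hrise : ∀ {t}, RisesAt α β k γ t → |(γ t).2 - y₀| < r := fun {t} ht => by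
    refine (hU ⟨t, rfl⟩ ht.1).resolve_right fun h1 => ?_
    linarith [(abs_lt.1 h1).2, ht.2.1]
  have hfall : ∀ {t}, FallsAt α β k γ t → |(γ t).2 + y₁| < r := fun {t} ht => by
    refine (hU ⟨t, rfl⟩ ht.1).resolve_left fun h1 => ?_
    linarith [(abs_lt.1 h1).1, ht.2.1]
  have hfall' : ∀ {t}, FallsAt α β k γ t → (γ t).2 < 0 := fun {t} ht => by
    linarith [(abs_lt.1 (hfall ht)).2]
  -- the excursion that follows a rise and the one that follows a fall
  have hR : ∀ {t}, RisesAt α β k γ t → ∃ t₂, t < t₂ ∧ FallsAt α β k γ t₂ ∧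
      t₂ - t = rightTime (γ t).2 (-(γ t₂).2) ∧ RightRel β (γ t).2 (-(γ t₂).2) ∧
      ∀ s ∈ Icc t t₂, γ s = rightArc β (γ t).2 (s - t) := fun {t} ht => by
    obtain ⟨t₂, hlt, hx, hno⟩ := exists_next hsol hT hper ht.1
    rcases excursion_cases hsol hlt ht.1 hx hno with ⟨-, hf, hin⟩ | ⟨hf, -, -⟩
    · exact ⟨t₂, hlt, hf, right_excursion hsol hβ hlt ht hf (hfall' hf) hin⟩
    · linarith [hf.2.1, ht.2.1]
  have hL : ∀ {t}, FallsAt α β k γ t → ∃ t₂, t < t₂ ∧ RisesAt α β k γ t₂ ∧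
      t₂ - t = leftTime α k (γ t₂).2 (-(γ t).2) ∧ LeftRel α k (γ t₂).2 (-(γ t).2) ∧
      ∀ s ∈ Icc t t₂, γ s = leftArc α k (-(γ t).2) (s - t) := fun {t} ht => by
    obtain ⟨t₂, hlt, hx, hno⟩ := exists_next hsol hT hper ht.1
    rcases excursion_cases hsol hlt ht.1 hx hno with ⟨hf, -, -⟩ | ⟨-, hf, hin⟩
    · linarith [hf.2.1, ht.2.1]
    · exact ⟨t₂, hlt, hf, left_excursion hsol h.left_pos hlt ht.1 hx hin⟩
  have hR' : ∀ {t}, FallsAt α β k γ t → ∃ t₁, RisesAt α β k γ t₁ ∧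
      RightRel β (γ t₁).2 (-(γ t).2) := fun {t} ht => by
    obtain ⟨t₁, hlt, hx, hno⟩ := exists_prev hsol hT hper ht.1
    rcases excursion_cases hsol hlt hx ht.1 hno with ⟨hf, -, hin⟩ | ⟨-, hf, -⟩
    · exact ⟨t₁, hf, (right_excursion hsol hβ hlt hf ht (hfall' ht) hin).2.1⟩
    · linarith [hf.2.1, ht.2.1]
  have hL' : ∀ {t}, RisesAt α β k γ t → ∃ t₁, FallsAt α β k γ t₁ ∧
      LeftRel α k (γ t).2 (-(γ t₁).2) := fun {t} ht => by
    obtain ⟨t₁, hlt, hx, hno⟩ := exists_prev hsol hT hper ht.1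
    rcases excursion_cases hsol hlt hx ht.1 hno with ⟨-, hf, -⟩ | ⟨hf, -, hin⟩
    · linarith [hf.2.1, ht.2.1]
    · exact ⟨t₁, hf, (left_excursion hsol h.left_pos hlt hx ht.1 hin).2.1⟩
  -- a fixed point of the return map is `y₀`
  have hfix : ∀ {t s}, RisesAt α β k γ t → FallsAt α β k γ s → RightRel β (γ t).2 (-(γ s).2) →
      LeftRel α k (γ t).2 (-(γ s).2) → (γ t).2 = y₀ := fun {t s} ht hs h1 h2 => by
    have hd : dist ((γ t).2, -(γ s).2) (y₀, y₁) < r₀ := by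
      rw [Prod.dist_eq, max_lt_iff, Real.dist_eq, Real.dist_eq,
        show -(γ s).2 - y₁ = -((γ s).2 + y₁) by ring, abs_neg]
      exact ⟨(hrise ht).trans_le hrr, (hfall hs).trans_le hrr⟩
    exact congrArg Prod.fst (hiso hd h1 h2)
  -- the return map is increasing
  have hmono : ∀ {t s t' s' u u'}, RisesAt α β k γ t → FallsAt α β k γ s → RisesAt α β k γ u →
      RisesAt α β k γ t' → FallsAt α β k γ s' → RisesAt α β k γ u' →
      RightRel β (γ t).2 (-(γ s).2) → LeftRel α k (γ u).2 (-(γ s).2) →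
      RightRel β (γ t').2 (-(γ s').2) → LeftRel α k (γ u').2 (-(γ s').2) →
      (γ t).2 ≤ (γ t').2 → (γ u).2 ≤ (γ u').2 := by
    intro t s t' s' u u' ht hs hu ht' hs' hu' h1 h2 h1' h2' hle
    refine h2.le h.left_pos h2' hu.2.2.1.le hu'.2.2.1.le (by linarith [hs.2.2.1]) ?_
    exact h1.le h1' ht.2.1.le (by linarith [hs.2.1]) (by linarith [hs'.2.1]) hle
  -- a rising crossing exists
  obtain ⟨t₀, ht₀⟩ : ∃ t, RisesAt α β k γ t := by
    obtain ⟨t, ht⟩ := exists_crossing hsol hα hβ.ne' hT hper hne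
    rcases risesAt_or_fallsAt hsol ht with h1 | h1
    · exact ⟨t, h1⟩
    · obtain ⟨t₁, h2, -⟩ := hR' h1
      exact ⟨t₁, h2⟩
  -- the rising crossings in one period form a compact set
  have hK : IsCompact {t | t ∈ Icc 0 T ∧ (γ t).1 = -1 ∧ 0 ≤ (γ t).2} := by
    refine isCompact_Icc.inter_right ((isClosed_crossing hsol).inter ?_)
    exact isClosed_le continuous_const (continuous_snd.comp hsol.continuous)
  have hmem : ∀ {t}, RisesAt α β k γ t →
      ∃ s ∈ {t | t ∈ Icc 0 T ∧ (γ t).1 = -1 ∧ 0 ≤ (γ t).2}, γ s = γ t := fun {t} ht => by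
    obtain ⟨s, hs, hs'⟩ := hper.exists_mem_Ico₀ hT t
    exact ⟨s, ⟨Ico_subset_Icc_self hs, hs' ▸ ht.1, hs' ▸ hβ0.trans ht.2.1.le⟩, hs'.symm⟩
  have hKrise : ∀ {t}, t ∈ {t | t ∈ Icc 0 T ∧ (γ t).1 = -1 ∧ 0 ≤ (γ t).2} →
      RisesAt α β k γ t := fun {t} ht =>
    (risesAt_or_fallsAt hsol ht.2.1).resolve_right fun hf => (hfall' hf).not_ge ht.2.2
  have hKne : {t | t ∈ Icc 0 T ∧ (γ t).1 = -1 ∧ 0 ≤ (γ t).2}.Nonempty :=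
    let ⟨s, hs, _⟩ := hmem ht₀; ⟨s, hs⟩
  have hyc : ContinuousOn (fun t => (γ t).2) {t | t ∈ Icc 0 T ∧ (γ t).1 = -1 ∧ 0 ≤ (γ t).2} :=
    (continuous_snd.comp hsol.continuous).continuousOn
  obtain ⟨tM, htM, hmax⟩ := hK.exists_isMaxOn hKne hyc
  obtain ⟨tm, htm, hmin⟩ := hK.exists_isMinOn hKne hyc
  have hle : ∀ {t}, RisesAt α β k γ t → (γ t).2 ≤ (γ tM).2 := fun {t} ht => by
    obtain ⟨s, hs, hs'⟩ := hmem ht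
    exact hs' ▸ hmax hs
  have hge : ∀ {t}, RisesAt α β k γ t → (γ tm).2 ≤ (γ t).2 := fun {t} ht => by
    obtain ⟨s, hs, hs'⟩ := hmem ht
    exact hs' ▸ hmin hs
  have hM : (γ tM).2 = y₀ := by
    have h1 := hKrise htM
    obtain ⟨s, -, hs, -, hs1, -⟩ := hR h1
    obtain ⟨u, -, hu, -, hu1, -⟩ := hL hs
    obtain ⟨s', hs', hs1'⟩ := hL' h1
    obtain ⟨p, hp, hp1⟩ := hR' hs'
    have e := le_antisymm (hle hu) (hmono hp hs' h1 h1 hs hu hp1 hs1' hs1 hu1 (hle hp))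
    exact hfix h1 hs hs1 (e ▸ hu1)
  have hm : (γ tm).2 = y₀ := by
    have h1 := hKrise htm
    obtain ⟨s, -, hs, -, hs1, -⟩ := hR h1
    obtain ⟨u, -, hu, -, hu1, -⟩ := hL hs
    obtain ⟨s', hs', hs1'⟩ := hL' h1
    obtain ⟨p, hp, hp1⟩ := hR' hs'
    have e := le_antisymm (hmono h1 hs hu hp hs' h1 hs1 hu1 hp1 hs1' (hge hp)) (hge hu)
    exact hfix h1 hs hs1 (e ▸ hu1)
  have hup : ∀ {t}, RisesAt α β k γ t → (γ t).2 = y₀ := fun {t} ht =>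
    le_antisymm (hM ▸ hle ht) (hm ▸ hge ht)
  have hdown : ∀ {t}, FallsAt α β k γ t → -(γ t).2 = y₁ := fun {t} ht => by
    obtain ⟨t₁, h1, h2⟩ := hR' ht
    rw [hup h1] at h2
    have hb := h.pos₁
    exact le_antisymm (h2.le h.right_rel h.right_up.le (by linarith [ht.2.1]) (by linarith) le_rfl)
      (h.right_rel.le h2 h.right_up.le (by linarith) (by linarith [ht.2.1]) le_rfl)
  -- the two arcs of the orbit
  have hRset : ∀ {t t₂}, RisesAt α β k γ t → FallsAt α β k γ t₂ →
      t₂ - t = rightTime (γ t).2 (-(γ t₂).2) → (∀ s ∈ Icc t t₂, γ s = rightArc β (γ t).2 (s - t)) →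
      γ '' Icc t t₂ = rightArc β y₀ '' Icc 0 (rightTime y₀ y₁) := by
    intro t t₂ h1 h2 h3 h4
    rw [hup h1] at h3 h4
    rw [hdown h2] at h3
    rw [← h3, ← sub_self t, ← image_sub_const_Icc, image_image]
    exact image_congr h4
  have hLset : ∀ {t t₂}, FallsAt α β k γ t → RisesAt α β k γ t₂ →
      t₂ - t = leftTime α k (γ t₂).2 (-(γ t).2) →
      (∀ s ∈ Icc t t₂, γ s = leftArc α k (-(γ t).2) (s - t)) →
      γ '' Icc t t₂ = leftArc α k y₁ '' Icc 0 (leftTime α k y₀ y₁) := by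
    intro t t₂ h1 h2 h3 h4
    rw [hdown h1] at h3 h4
    rw [hup h2] at h3
    rw [← h3, ← sub_self t, ← image_sub_const_Icc, image_image]
    exact image_congr h4
  apply Subset.antisymm
  · rintro _ ⟨t, rfl⟩
    -- the last crossing before `t` starts an excursion that contains `t`
    obtain ⟨s, hs, hs'⟩ := hper.exists_mem_Ico hT t t₀
    obtain ⟨c, hc, hcs, hlast⟩ := exists_last (isClosed_crossing hsol) hs.1 ht₀.1
    rw [hs']
    rcases risesAt_or_fallsAt hsol hc with h1 | h1
    · obtain ⟨t₂, hlt, h2, h3, -, h5⟩ := hR h1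
      have hst : s ≤ t₂ := by
        by_contra! hlt'
        exact hlast t₂ hlt hlt'.le h2.1
      exact Or.inl (hRset h1 h2 h3 h5 ▸ mem_image_of_mem γ ⟨hcs, hst⟩)
    · obtain ⟨t₂, hlt, h2, h3, -, h5⟩ := hL h1
      have hst : s ≤ t₂ := by
        by_contra! hlt'
        exact hlast t₂ hlt hlt'.le h2.1
      exact Or.inr (hLset h1 h2 h3 h5 ▸ mem_image_of_mem γ ⟨hcs, hst⟩)
  · obtain ⟨t₁, -, h1, h2, -, h3⟩ := hR ht₀
    obtain ⟨t₂, -, h4, h5, -, h6⟩ := hL h1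
    rw [cycle, ← hRset ht₀ h1 h2 h3, ← hLset h1 h4 h5 h6]
    exact union_subset (image_subset_range _ _) (image_subset_range _ _)

/-- The periodic orbits visit the three zones. -/
theorem cycle_inter_region {α β k y₀ y₁ : ℝ} (h : CycleData α β k y₀ y₁) (z : Zone) :
    (cycle α β k y₀ y₁ ∩ z.region).Nonempty := by
  have hpi := Real.pi_pos
  have b0 : 0 < Real.arctan y₀ := Real.arctan_pos.2 h.pos₀
  have b1 := Real.arctan_lt_pi_div_two y₀
  have b2 := Real.arctan_lt_pi_div_two y₁
  have hp := fun t => (spiral_polar (c := β) (u₀ := y₀) one_pos t).1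
  cases z
  · refine ⟨leftArc α k y₁ (leftTime α k y₀ y₁ / 2),
      Or.inr ⟨_, ⟨?_, ?_⟩, rfl⟩, h.leftArc_lt ⟨?_, ?_⟩⟩
      <;> linarith [h.leftTime_pos]
  · refine ⟨rightArc β y₀ (Real.pi / 2 - Real.arctan y₀), Or.inl ⟨_, ⟨?_, ?_⟩, rfl⟩, ?_⟩
    · linarith
    · simp only [rightTime]; linarith
    · have : (rightArc β y₀ (Real.pi / 2 - Real.arctan y₀)).1 = 0 := by
        rw [rightArc, hp, div_one, sub_add_cancel, Real.cos_pi_div_two]; simp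
      simp [Zone.region, this]
  · refine ⟨rightArc β y₀ (Real.pi - Real.arctan y₀), Or.inl ⟨_, ⟨?_, ?_⟩, rfl⟩, ?_⟩
    · linarith
    · simp only [rightTime]; linarith
    · have h1 : 1 ≤ Real.exp (β * (Real.pi - Real.arctan y₀)) :=
        Real.one_le_exp (mul_nonneg h.nonneg (by linarith))
      have h2 : 1 < Real.sqrt (1 ^ 2 + y₀ ^ 2) := by
        rw [Real.lt_sqrt zero_le_one]; have := h.pos₀; nlinarith
      have : (rightArc β y₀ (Real.pi - Real.arctan y₀)).1 =
          Real.exp (β * (Real.pi - Real.arctan y₀)) * Real.sqrt (1 ^ 2 + y₀ ^ 2) := by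
        rw [rightArc, hp, div_one, sub_add_cancel, Real.cos_pi]; simp
      simp only [Zone.region, mem_ofPred_eq, this]
      nlinarith

/-! ### Convergence in the Hausdorff distance -/

theorem tendsto_hausdorffEDist_image {X : Type*} [TopologicalSpace X] {F : X → ℝ → ℝ × ℝ}
    {K : Set ℝ} (hK : IsCompact K) {p₀ : X}
    (hF : ∀ u ∈ K, ContinuousAt (fun q : X × ℝ => F q.1 q.2) (p₀, u)) :
    Tendsto (fun p => Metric.hausdorffEDist (F p '' K) (F p₀ '' K)) (𝓝 p₀) (𝓝 0) := by
  rw [ENNReal.tendsto_nhds_zero]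
  intro ε hε
  have key : ∀ᶠ p in 𝓝 p₀, ∀ u ∈ K, edist (F p u) (F p₀ u) < ε := by
    refine hK.eventually_forall_of_forall_eventually fun u hu => ?_
    have h1 : Tendsto (fun q : X × ℝ => F q.1 q.2) (𝓝 (p₀, u)) (𝓝 (F p₀ u)) := hF u hu
    have hc : Tendsto (fun q : X × ℝ => (p₀, q.2)) (𝓝 (p₀, u)) (𝓝 (p₀, u)) :=
      (Continuous.tendsto (by fun_prop) (p₀, u))
    have h2 : Tendsto (fun q : X × ℝ => F p₀ q.2) (𝓝 (p₀, u)) (𝓝 (F p₀ u)) := h1.comp hc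
    have h3 := h1.edist h2
    rw [edist_self] at h3
    exact h3.eventually (gt_mem_nhds hε)
  filter_upwards [key] with p hp
  refine Metric.hausdorffEDist_le_of_mem_edist ?_ ?_
  · rintro _ ⟨u, hu, rfl⟩
    exact ⟨_, mem_image_of_mem _ hu, (hp u hu).le⟩
  · rintro _ ⟨u, hu, rfl⟩
    exact ⟨_, mem_image_of_mem _ hu, by rw [edist_comm]; exact (hp u hu).le⟩

theorem image_Icc_zero_eq (f : ℝ → ℝ × ℝ) {τ : ℝ} (hτ : 0 ≤ τ) :
    f '' Icc 0 τ = (fun u => f (τ * u)) '' Icc 0 1 := by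
  rw [← image_image f (fun u => τ * u), image_mul_left_Icc hτ zero_le_one]
  simp

theorem continuous_rightTime : Continuous fun p : ℝ × ℝ => rightTime p.1 p.2 := by
  have := Real.continuous_arctan
  unfold rightTime
  fun_prop

theorem continuousAt_leftTime {α k y₀ y₁ : ℝ} (hd : leftDist α k ≠ 0) :
    ContinuousAt (fun p : ℝ × ℝ × ℝ × ℝ => leftTime p.1 p.2.1 p.2.2.1 p.2.2.2) (α, k, y₀, y₁) := by
  have hs : Continuous fun p : ℝ × ℝ × ℝ × ℝ => leftShift p.1 p.2.1 := by
    unfold leftShift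
    exact Continuous.div (by fun_prop) (by fun_prop) fun p => by positivity
  have hl : Continuous fun p : ℝ × ℝ × ℝ × ℝ => leftDist p.1 p.2.1 := by
    unfold leftDist
    exact continuous_const.add
      (Continuous.div (by fun_prop) (by fun_prop) fun p => by positivity)
  have h0 : Continuous fun p : ℝ × ℝ × ℝ × ℝ => p.2.2.1 - leftShift p.1 p.2.1 := by fun_prop
  have h1 : Continuous fun p : ℝ × ℝ × ℝ × ℝ => p.2.2.2 + leftShift p.1 p.2.1 := by fun_prop
  unfold leftTime
  exact (Real.continuous_arctan.continuousAt.comp (h0.continuousAt.div hl.continuousAt hd)).add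
    (Real.continuous_arctan.continuousAt.comp (h1.continuousAt.div hl.continuousAt hd))

theorem continuous_leftArc :
    Continuous fun p : (ℝ × ℝ × ℝ) × ℝ => leftArc p.1.1 p.1.2.1 p.1.2.2 p.2 := by
  have hs : Continuous fun p : (ℝ × ℝ × ℝ) × ℝ => leftShift p.1.1 p.1.2.1 := by
    unfold leftShift
    exact Continuous.div (by fun_prop) (by fun_prop) fun p => by positivity
  have hl : Continuous fun p : (ℝ × ℝ × ℝ) × ℝ => leftDist p.1.1 p.1.2.1 := by
    unfold leftDist
    exact continuous_const.add
      (Continuous.div (by fun_prop) (by fun_prop) fun p => by positivity)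
  unfold leftArc spiralU spiralV
  fun_prop

theorem tendsto_hausdorffEDist_cycle {ι : Type*} {l : Filter ι} {α β k y₀ y₁ : ι → ℝ} {h : ℝ}
    (hh : 0 < h) (hα : Tendsto α l (𝓝 0)) (hβ : Tendsto β l (𝓝 0)) (hk : Tendsto k l (𝓝 0))
    (h0 : Tendsto y₀ l (𝓝 h)) (h1 : Tendsto y₁ l (𝓝 h)) :
    Tendsto (fun i => Metric.hausdorffEDist (cycle (α i) (β i) (k i) (y₀ i) (y₁ i))
      (cycle 0 0 0 h h)) l (𝓝 0) := by
  have hd0 : leftDist 0 0 ≠ 0 := by simp [leftDist]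
  have ht0 : 0 < leftTime 0 0 h h := by
    have : 0 < Real.arctan (h / 2) := Real.arctan_pos.2 (by positivity)
    simp [leftTime, leftDist, leftShift, this]
  have hlt : ∀ᶠ i in l, 0 < leftTime (α i) (k i) (y₀ i) (y₁ i) :=
    ((continuousAt_leftTime (y₀ := h) (y₁ := h) hd0).tendsto.comp
      (hα.prodMk_nhds (hk.prodMk_nhds (h0.prodMk_nhds h1)))).eventually (lt_mem_nhds ht0)
  have hr : Tendsto (fun i => Metric.hausdorffEDist
      (rightArc (β i) (y₀ i) '' Icc 0 (rightTime (y₀ i) (y₁ i)))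
      (rightArc 0 h '' Icc 0 (rightTime h h))) l (𝓝 0) := by
    simp only [image_Icc_zero_eq _ (rightTime_pos _ _).le]
    refine (tendsto_hausdorffEDist_image (p₀ := ((0 : ℝ), h, h))
      (F := fun p u => rightArc p.1 p.2.1 (rightTime p.2.1 p.2.2 * u)) isCompact_Icc
      fun u _ => ?_).comp (hβ.prodMk_nhds (h0.prodMk_nhds h1))
    refine Continuous.continuousAt ?_
    have ht : Continuous fun q : (ℝ × ℝ × ℝ) × ℝ => rightTime q.1.2.1 q.1.2.2 :=
      continuous_rightTime.comp (by fun_prop : Continuous fun q : (ℝ × ℝ × ℝ) × ℝ =>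
        (q.1.2.1, q.1.2.2))
    unfold rightArc spiralU spiralV
    fun_prop
  have hl : Tendsto (fun i => Metric.hausdorffEDist
      (leftArc (α i) (k i) (y₁ i) '' Icc 0 (leftTime (α i) (k i) (y₀ i) (y₁ i)))
      (leftArc 0 0 h '' Icc 0 (leftTime 0 0 h h))) l (𝓝 0) := by
    have := (tendsto_hausdorffEDist_image (p₀ := ((0 : ℝ), (0 : ℝ), h, h))
      (F := fun p u => leftArc p.1 p.2.1 p.2.2.2 (leftTime p.1 p.2.1 p.2.2.1 p.2.2.2 * u))
      (isCompact_Icc (a := (0 : ℝ)) (b := 1)) fun u _ => ?_).comp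
        (hα.prodMk_nhds (hk.prodMk_nhds (h0.prodMk_nhds h1)))
    · refine this.congr' ?_
      filter_upwards [hlt] with i hi
      rw [image_Icc_zero_eq _ ht0.le, image_Icc_zero_eq _ hi.le]
      rfl
    · have ht : ContinuousAt (fun q : (ℝ × ℝ × ℝ × ℝ) × ℝ =>
          leftTime q.1.1 q.1.2.1 q.1.2.2.1 q.1.2.2.2 * q.2) ((0, 0, h, h), u) :=
        (ContinuousAt.comp (f := fun q : (ℝ × ℝ × ℝ × ℝ) × ℝ => q.1)
          (g := fun p : ℝ × ℝ × ℝ × ℝ => leftTime p.1 p.2.1 p.2.2.1 p.2.2.2)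
          (x := (((0 : ℝ), (0 : ℝ), h, h), u))
          (continuousAt_leftTime (y₀ := h) (y₁ := h) hd0) continuousAt_fst).mul continuousAt_snd
      have hp : ContinuousAt (fun q : (ℝ × ℝ × ℝ × ℝ) × ℝ => (q.1.1, q.1.2.1, q.1.2.2.2))
          ((0, 0, h, h), u) := Continuous.continuousAt (by fun_prop)
      exact ContinuousAt.comp (x := (((0 : ℝ), (0 : ℝ), h, h), u))
        (f := fun q : (ℝ × ℝ × ℝ × ℝ) × ℝ => ((q.1.1, q.1.2.1, q.1.2.2.2),
          leftTime q.1.1 q.1.2.1 q.1.2.2.1 q.1.2.2.2 * q.2))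
        (g := fun p : (ℝ × ℝ × ℝ) × ℝ => leftArc p.1.1 p.1.2.1 p.1.2.2 p.2)
        continuous_leftArc.continuousAt (hp.prodMk ht)
  refine tendsto_of_tendsto_of_tendsto_of_le_of_le tendsto_const_nhds
    (by simpa using hr.max hl) (fun _ => zero_le) fun i => ?_
  exact Metric.hausdorffEDist_union_le

/-! ### The unperturbed annulus -/

theorem cycleData_zero {h : ℝ} (hh : 0 < h) : CycleData 0 0 0 h h where
  nonneg := le_rfl
  pos₁ := hh
  right_up := hh
  left_pos := by simp [leftDist]
  left_up := by simpa using hh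
  left_down := by simpa using hh
  right_rel := by simp [RightRel]
  left_rel := by simp [LeftRel, leftShift]

theorem exists_polar (v u : ℝ) : ∃ θ ∈ Ioc (-Real.pi) Real.pi,
    v = Real.sqrt (v ^ 2 + u ^ 2) * Real.cos θ ∧ u = Real.sqrt (v ^ 2 + u ^ 2) * Real.sin θ := by
  have hn : ‖(⟨v, u⟩ : ℂ)‖ = Real.sqrt (v ^ 2 + u ^ 2) := Complex.norm_eq_sqrt_sq_add_sq _
  refine ⟨Complex.arg ⟨v, u⟩, Complex.arg_mem_Ioc _, ?_, ?_⟩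
  · rw [← hn, Complex.norm_mul_cos_arg]
  · rw [← hn, Complex.norm_mul_sin_arg]

theorem mul_cos_arctan_div {d u : ℝ} (hd : 0 < d) :
    Real.sqrt (d ^ 2 + u ^ 2) * Real.cos (Real.arctan (u / d)) = d := by
  have := (spiral_polar (c := 0) (u₀ := u) hd 0).1
  simpa using this.symm

theorem mem_rightArc_zero {h x y : ℝ} (hh : 0 < h) (hx : -1 ≤ x) (hxy : x ^ 2 + y ^ 2 = 1 + h ^ 2) :
    (x, y) ∈ rightArc 0 h '' Icc 0 (rightTime h h) := by
  have hpi := Real.pi_pos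
  obtain ⟨θ, hθ, hc, hs⟩ := exists_polar (-x) y
  rw [neg_sq, hxy] at hc hs
  have hr : 0 < Real.sqrt (1 + h ^ 2) := Real.sqrt_pos.2 (by positivity)
  have e := mul_cos_arctan_div (u := h) one_pos
  rw [one_pow, div_one] at e
  have b0 : 0 < Real.arctan h := Real.arctan_pos.2 hh
  have b1 := Real.arctan_lt_pi_div_two h
  have hcos : Real.cos θ ≤ Real.cos (Real.arctan h) := by
    refine le_of_mul_le_mul_left ?_ hr
    rw [← hc, e]; linarith
  have habs : Real.arctan h ≤ |θ| := by
    by_contra! hlt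
    rw [← Real.cos_abs θ] at hcos
    linarith [Real.cos_lt_cos_of_nonneg_of_le_pi (abs_nonneg θ) (by linarith) hlt]
  have hmk : ∀ t, Real.cos (t + Real.arctan h) = Real.cos θ →
      Real.sin (t + Real.arctan h) = Real.sin θ → rightArc 0 h t = (x, y) := by
    intro t h1 h2
    obtain ⟨h3, h4⟩ := spiral_polar (c := 0) (u₀ := h) one_pos t
    rw [rightArc, h3, h4, div_one, h1, h2, zero_mul, Real.exp_zero, one_mul, one_pow, ← hc, ← hs,
      neg_neg]
  rcases le_or_gt 0 θ with h0 | h0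
  · rw [abs_of_nonneg h0] at habs
    refine ⟨θ - Real.arctan h, ⟨by linarith, ?_⟩, hmk _ (by rw [sub_add_cancel])
      (by rw [sub_add_cancel])⟩
    simp only [rightTime]; linarith [hθ.2]
  · rw [abs_of_neg h0] at habs
    have e2 : θ + 2 * Real.pi - Real.arctan h + Real.arctan h = θ + 2 * Real.pi := by ring
    refine ⟨θ + 2 * Real.pi - Real.arctan h, ⟨by linarith [hθ.1], ?_⟩, hmk _
      (by rw [e2, Real.cos_add_two_pi]) (by rw [e2, Real.sin_add_two_pi])⟩
    simp only [rightTime]; linarith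

theorem mem_leftArc_zero {h x y : ℝ} (hh : 0 < h) (hx : x < -1)
    (hxy : (2 - (x + 1) / 2) ^ 2 + ((x + 2 * y + 1) / 2) ^ 2 = 2 ^ 2 + h ^ 2) :
    (x, y) ∈ leftArc 0 0 h '' Icc 0 (leftTime 0 0 h h) := by
  obtain ⟨θ, hθ, hc, hs⟩ := exists_polar (2 - (x + 1) / 2) ((x + 2 * y + 1) / 2)
  rw [hxy] at hc hs
  have hr : 0 < Real.sqrt (2 ^ 2 + h ^ 2) := Real.sqrt_pos.2 (by positivity)
  have e := mul_cos_arctan_div (u := h) two_pos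
  have b0 : 0 < Real.arctan (h / 2) := Real.arctan_pos.2 (by positivity)
  have hcos : Real.cos (Real.arctan (h / 2)) < Real.cos θ := by
    refine lt_of_mul_lt_mul_left ?_ hr.le
    rw [← hc, e]; linarith
  have habs : |θ| < Real.arctan (h / 2) := by
    by_contra! hlt
    rw [← Real.cos_abs θ] at hcos
    linarith [Real.cos_le_cos_of_nonneg_of_le_pi b0.le (abs_le.2 ⟨hθ.1.le, hθ.2⟩) hlt]
  obtain ⟨h1, h2⟩ := abs_lt.1 habs
  refine ⟨θ + Real.arctan (h / 2), ⟨by linarith, ?_⟩, ?_⟩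
  · simp [leftTime, leftDist, leftShift]; linarith
  · obtain ⟨h3, h4⟩ := spiral_polar (c := 0) (u₀ := -h) two_pos (θ + Real.arctan (h / 2))
    rw [neg_div, Real.arctan_neg, add_neg_cancel_right, zero_mul, Real.exp_zero, one_mul,
      neg_sq] at h3 h4
    rw [← hc] at h3
    rw [← hs] at h4
    simp only [leftArc, leftDist, leftShift, zero_mul, zero_div, add_zero, h3, h4]
    ext <;> simp <;> ring

theorem cycle_zero_eq {h : ℝ} (hh : 0 < h) : cycle 0 0 0 h h = annulusOrbit virtualCenters h := by
  have hD := cycleData_zero hh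
  have hmem : ∀ x y : ℝ, -1 ≤ x → x ^ 2 + y ^ 2 = 1 + h ^ 2 →
      (x, y) ∈ annulusOrbit virtualCenters h := by
    intro x y hx hxy
    rcases lt_or_ge 1 x with h1 | h1
    · refine Or.inl (Or.inl (Or.inl ⟨?_, h1⟩))
      simp only [HamCoeffs.H, virtualCenters, normalForm]
      linear_combination hxy / 2
    · have hy : y ≠ 0 := by
        rintro rfl
        nlinarith
      rcases lt_or_gt_of_ne hy with h2 | h2
      · refine Or.inl (Or.inl (Or.inr ⟨?_, hx, h1, h2⟩))
        simp only [HamCoeffs.H, virtualCenters, normalForm]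
        linear_combination hxy / 2
      · refine Or.inr ⟨?_, hx, h1, h2⟩
        simp only [HamCoeffs.H, virtualCenters, normalForm]
        linear_combination hxy / 2
  apply Subset.antisymm
  · rintro P (⟨t, ht, rfl⟩ | ⟨t, ht, rfl⟩)
    · have hsq := spiral_sq 0 h 1 t
      simp only [mul_zero, zero_mul, Real.exp_zero, one_mul, one_pow] at hsq
      refine hmem _ _ ?_ (by rw [neg_sq]; exact hsq)
      rcases ht.1.eq_or_lt with h0 | h0
      · simp [← h0]
      rcases ht.2.eq_or_lt with h1 | h1
      · have := congrArg Prod.fst hD.rightArc_end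
        rw [← h1] at this
        exact this.ge
      · exact (hD.lt_rightArc ⟨h0, h1⟩).le
    · rcases ht.1.eq_or_lt with h0 | h0
      · rw [← h0, leftArc_zero]
        exact hmem _ _ le_rfl (by ring)
      rcases ht.2.eq_or_lt with h1 | h1
      · rw [h1, hD.leftArc_end]
        exact hmem _ _ le_rfl (by ring)
      · refine Or.inl (Or.inr ⟨?_, hD.leftArc_lt ⟨h0, h1⟩⟩)
        have hsq := spiral_sq 0 (-(h + leftShift 0 0)) (leftDist 0 0) t
        simp only [mul_zero, zero_mul, Real.exp_zero, one_mul, leftShift, leftDist, zero_div,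
          add_zero, neg_sq] at hsq
        simp only [HamCoeffs.H, virtualCenters, normalForm, leftArc, leftShift, leftDist, zero_mul,
          zero_div, add_zero]
        linear_combination hsq
  · rintro ⟨x, y⟩ (((⟨h1, h2⟩ | ⟨h1, h2, h3, h4⟩) | ⟨h1, h2⟩) | ⟨h1, h2, h3, h4⟩) <;>
      simp only [HamCoeffs.H, virtualCenters, normalForm] at h1
    · exact Or.inl (mem_rightArc_zero hh (by simp only at h2; linarith)
        (by linear_combination 2 * h1))
    · exact Or.inl (mem_rightArc_zero hh h2 (by linear_combination 2 * h1))
    · exact Or.inr (mem_leftArc_zero hh h2 (by linear_combination h1))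
    · exact Or.inl (mem_rightArc_zero hh h2 (by linear_combination 2 * h1))

/-! ### Three simple zeros of the Melnikov function -/

theorem sub_cube_le_arctan {t : ℝ} (ht : 0 ≤ t) : t - t ^ 3 / 3 ≤ Real.arctan t := by
  have hd : ∀ s : ℝ, HasDerivAt (fun s => Real.arctan s - (s - s ^ 3 / 3))
      (s ^ 4 / (1 + s ^ 2)) s := by
    intro s
    have h := (Real.hasDerivAt_arctan s).sub
      ((hasDerivAt_id s).sub ((hasDerivAt_pow 3 s).div_const 3))
    refine h.congr_deriv ?_
    have : 1 + s ^ 2 ≠ 0 := by positivity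
    field_simp
    push_cast
    ring
  have hm : Monotone fun s => Real.arctan s - (s - s ^ 3 / 3) :=
    monotone_of_hasDerivAt_nonneg hd fun s => by positivity
  have := hm ht
  simp only [Real.arctan_zero] at this
  linarith

theorem arctan_le_self {t : ℝ} (ht : 0 ≤ t) : Real.arctan t ≤ t := by
  have hd : ∀ s : ℝ, HasDerivAt (fun s => s - Real.arctan s) (s ^ 2 / (1 + s ^ 2)) s := by
    intro s
    refine ((hasDerivAt_id s).sub (Real.hasDerivAt_arctan s)).congr_deriv ?_
    have : 1 + s ^ 2 ≠ 0 := by positivity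
    field_simp
    ring
  have hm : Monotone fun s => s - Real.arctan s :=
    monotone_of_hasDerivAt_nonneg hd fun s => by positivity
  have := hm ht
  simp only [Real.arctan_zero] at this
  linarith

/-- The value of the drift `κ` for which the Melnikov function with `a = -21/20`, `b = 1` vanishes
at `m`. It tends to `-∞` at `0`, and to `∞` at `∞` because `-a > b`; as `-a` exceeds `b` only
slightly, it is not monotone in between. -/
noncomputable def drift (m : ℝ) : ℝ :=
  -(rightMelnikov 1 m + leftMelnikov (-21 / 20) m) / (2 * m)

theorem melnikov_eq {κ m : ℝ} (hm : m ≠ 0) :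
    melnikov (-21 / 20) 1 κ m = 2 * m * (κ - drift m) := by
  rw [melnikov, drift]; field_simp; ring

theorem differentiableAt_drift {m : ℝ} (hm : m ≠ 0) : DifferentiableAt ℝ drift m := by
  have h1 := differentiable_rightMelnikov 1
  have h2 := differentiable_leftMelnikov (-21 / 20)
  unfold drift
  exact ((h1 m).add (h2 m)).neg.div (by fun_prop) (by positivity)

theorem drift_eq {m : ℝ} (hm : 0 < m) : drift m =
    21 / 20 * (4 + m ^ 2) / m * Real.arctan (m / 2) -
      (1 + m ^ 2) / m * (Real.pi / 2 + Real.arctan m⁻¹) := by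
  rw [drift, rightMelnikov, leftMelnikov, Real.arctan_inv_of_pos hm]
  field_simp
  ring

theorem drift_one_tenth_lt : drift (1 / 10) < -19 / 10 := by
  rw [drift_eq (by norm_num)]
  have h1 := arctan_le_self (t := 1 / 10 / 2) (by norm_num)
  have h2 : 0 < Real.arctan (10 : ℝ) := Real.arctan_pos.2 (by norm_num)
  have h3 := Real.pi_gt_three
  norm_num at h1 ⊢
  linarith

theorem lt_drift_two : -37 / 20 < drift 2 := by
  rw [drift_eq (by norm_num)]
  have h1 := sub_cube_le_arctan (t := (3 : ℝ)⁻¹) (by norm_num)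
  have h2 := Real.arctan_inv_2_add_arctan_inv_3
  have h3 := Real.pi_lt_d2
  rw [show (2 : ℝ) / 2 = 1 by norm_num, Real.arctan_one]
  norm_num at h1 h2 ⊢
  linarith

theorem drift_six_lt : drift 6 < -19 / 10 := by
  rw [drift_eq (by norm_num)]
  have h1 := sub_cube_le_arctan (t := (3 : ℝ)⁻¹) (by norm_num)
  have h2 := sub_cube_le_arctan (t := (6 : ℝ)⁻¹) (by norm_num)
  have h3 := Real.pi_lt_d2
  have h4 := Real.arctan_inv_of_pos (x := 3) (by norm_num)
  rw [show (6 : ℝ) / 2 = 3 by norm_num]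
  norm_num at h1 h2 h4 ⊢
  linarith

theorem lt_drift_hundred : -37 / 20 < drift 100 := by
  rw [drift_eq (by norm_num)]
  have h1 := arctan_le_self (t := (50 : ℝ)⁻¹) (by norm_num)
  have h2 := arctan_le_self (t := (100 : ℝ)⁻¹) (by norm_num)
  have h3 := Real.pi_gt_three
  have h4 := Real.arctan_inv_of_pos (x := 50) (by norm_num)
  rw [show (100 : ℝ) / 2 = 50 by norm_num]
  norm_num at h1 h2 h4 ⊢
  linarith

/-- By Sard's theorem almost every value of `drift` is regular. -/
theorem exists_regular_drift :
    ∃ κ ∈ Ioo (-19 / 10 : ℝ) (-37 / 20), ∀ m > 0, drift m = κ → deriv drift m ≠ 0 := by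
  have h0 : MeasureTheory.volume (drift '' {m | 0 < m ∧ deriv drift m = 0}) = 0 := by
    refine MeasureTheory.addHaar_image_eq_zero_of_det_fderivWithin_eq_zero _
      (f' := fun m => fderiv ℝ drift m) (fun m hm => ?_) (fun m hm => ?_)
    · exact (differentiableAt_drift hm.1.ne').hasFDerivAt.hasFDerivWithinAt
    · have : fderiv ℝ drift m = 0 := by
        ext
        simpa using hm.2
      rw [this]
      simp [ContinuousLinearMap.det]
  by_contra! hno
  have hsub : Ioo (-19 / 10 : ℝ) (-37 / 20) ⊆ drift '' {m | 0 < m ∧ deriv drift m = 0} := by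
    intro κ hκ
    obtain ⟨m, hm, h1, h2⟩ := hno κ hκ
    exact ⟨m, ⟨hm, h2⟩, h1⟩
  have := MeasureTheory.measure_mono_null hsub h0
  rw [Real.volume_Ioo, ENNReal.ofReal_eq_zero] at this
  norm_num at this

theorem exists_three_simple_zeros : ∃ (κ : ℝ) (h : Fin 3 → ℝ), StrictMono h ∧ (∀ i, 0 < h i) ∧
    ∀ i, melnikov (-21 / 20) 1 κ (h i) = 0 ∧ deriv (melnikov (-21 / 20) 1 κ) (h i) ≠ 0 := by
  obtain ⟨κ, ⟨hκ1, hκ2⟩, hreg⟩ := exists_regular_drift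
  have hcont : ∀ {s t : ℝ}, 0 < s → ContinuousOn drift (Icc s t) := fun {s t} hs m hm =>
    (differentiableAt_drift (hs.trans_le hm.1).ne').continuousAt.continuousWithinAt
  have a1 := drift_one_tenth_lt
  have a2 := lt_drift_two
  have a3 := drift_six_lt
  have a4 := lt_drift_hundred
  obtain ⟨h₁, hm₁, e₁⟩ := intermediate_value_Ioo (show (1 / 10 : ℝ) ≤ 2 by norm_num)
    (hcont (by norm_num)) (show κ ∈ Ioo _ _ from ⟨by linarith, by linarith⟩)
  obtain ⟨h₂, hm₂, e₂⟩ := intermediate_value_Ioo' (show (2 : ℝ) ≤ 6 by norm_num)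
    (hcont (by norm_num)) (show κ ∈ Ioo _ _ from ⟨by linarith, by linarith⟩)
  obtain ⟨h₃, hm₃, e₃⟩ := intermediate_value_Ioo (show (6 : ℝ) ≤ 100 by norm_num)
    (hcont (by norm_num)) (show κ ∈ Ioo _ _ from ⟨by linarith, by linarith⟩)
  have key : ∀ m > 0, drift m = κ → melnikov (-21 / 20) 1 κ m = 0 ∧
      deriv (melnikov (-21 / 20) 1 κ) m ≠ 0 := by
    intro m hm he
    refine ⟨by rw [melnikov_eq hm.ne', he, sub_self, mul_zero], ?_⟩
    have hev : melnikov (-21 / 20) 1 κ =ᶠ[𝓝 m] fun m => 2 * m * (κ - drift m) := by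
      filter_upwards [lt_mem_nhds hm] with s hs using melnikov_eq hs.ne'
    have hd := ((hasDerivAt_id m).const_mul 2).mul
      ((differentiableAt_drift hm.ne').hasDerivAt.const_sub κ)
    rw [hev.deriv_eq, HasDerivAt.deriv (f := fun m => 2 * m * (κ - drift m)) hd]
    simp only [id, he, sub_self, mul_zero, zero_add, mul_neg, neg_ne_zero]
    exact mul_ne_zero (by positivity) (hreg m hm he)
  have p₁ : 0 < h₁ := by linarith [hm₁.1]
  have p₂ : 0 < h₂ := by linarith [hm₂.1]
  have p₃ : 0 < h₃ := by linarith [hm₃.1]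
  refine ⟨κ, ![h₁, h₂, h₃], ?_, ?_, ?_⟩
  · rw [Fin.strictMono_iff_lt_succ]
    intro i
    fin_cases i
    · exact hm₁.2.trans hm₂.1
    · exact hm₂.2.trans hm₃.1
  · intro i
    fin_cases i
    exacts [p₁, p₂, p₃]
  · intro i
    fin_cases i
    exacts [key _ p₁ e₁, key _ p₂ e₂, key _ p₃ e₃]

theorem isCenterAt_of_eq {K : HamCoeffs} {P : ℝ × ℝ} (h1 : K.b * P.2 + K.a * P.1 + K.α = 0)
    (h2 : K.c * P.1 - K.a * P.2 + K.β = 0) (h3 : -K.a ^ 2 - K.b * K.c = 1) : K.IsCenterAt P := by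
  have h := field_eq K ⟨0, 0, 0, 0, 0, 0⟩ 0 P
  simp only [field, zero_mul, add_zero, h1, h2, Prod.mk.injEq, neg_eq_zero] at h
  refine ⟨h.1, h.2, 1, one_pos, ?_⟩
  rw [Matrix.charpoly_fin_two]
  have ht : K.linearPart.trace = 0 := by simp [HamCoeffs.linearPart, Matrix.trace_fin_two]
  have hdet : K.linearPart.det = 1 := by
    rw [HamCoeffs.linearPart, Matrix.det_fin_two_of]; linarith
  rw [ht, hdet]
  simp

/-- Along the branch of solutions of the bifurcation equations the data are those of a cycle. -/
theorem eventually_cycleData {a κ h : ℝ} {y₀ y₁ : ℝ → ℝ} (hh : 0 < h)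
    (h0 : Tendsto y₀ (𝓝[>] 0) (𝓝 h)) (h1 : Tendsto y₁ (𝓝[>] 0) (𝓝 h))
    (hrel : ∀ᶠ ε in 𝓝[>] (0 : ℝ),
      RightRel (ε * 1) (y₀ ε) (y₁ ε) ∧ LeftRel (ε * a) (ε * κ) (y₀ ε) (y₁ ε)) :
    ∀ᶠ ε in 𝓝[>] (0 : ℝ), CycleData (ε * a) (ε * 1) (ε * κ) (y₀ ε) (y₁ ε) := by
  have hlim : ∀ {f : ℝ → ℝ}, Continuous f → Tendsto f (𝓝[>] 0) (𝓝 (f 0)) := fun hf =>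
    (hf.tendsto 0).mono_left nhdsWithin_le_nhds
  have hs : Continuous fun ε : ℝ => 2 * (ε * a) + ε * κ := by fun_prop
  have hd : Continuous fun ε : ℝ => leftDist (ε * a) (ε * κ) := by
    unfold leftDist
    exact continuous_const.add
      (Continuous.div (by fun_prop) (by fun_prop) fun ε => by positivity)
  filter_upwards [hrel, self_mem_nhdsWithin, h1.eventually (lt_mem_nhds hh),
    (hlim (f := fun ε => ε * 1) (by fun_prop)).eventually_lt h0 (by simpa using hh),
    (hlim hs).eventually_lt h0 (by simpa using hh),
    h1.neg.eventually_lt (hlim hs) (by simpa using hh),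
    (hlim hd).eventually (lt_mem_nhds (a := 0) (by simp [leftDist]))] with ε e1 e2 e3 e4 e5 e6 e7
  exact ⟨by simpa using (mem_Ioi.1 e2).le, e3, e4, e7, e5, e6, e1.1, e1.2⟩

end ThreeZone

theorem mainTheorem10 :
    -- all three subsystems of the unperturbed system have centers, the outer ones are virtual
    ((∃ P, (ThreeZone.virtualCenters .L).IsCenterAt P ∧ P ∉ ThreeZone.Zone.L.region) ∧
      (∃ P, (ThreeZone.virtualCenters .C).IsCenterAt P ∧ P ∈ ThreeZone.Zone.C.region) ∧
      (∃ P, (ThreeZone.virtualCenters .R).IsCenterAt P ∧ P ∉ ThreeZone.Zone.R.region)) ∧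
    -- the unperturbed system has the annulus of periodic orbits `L_h`, `h > 0`
    (∀ (w : ThreeZone.Zone → ThreeZone.PertCoeffs) (h : ℝ), 0 < h →
      ThreeZone.IsPeriodicOrbit (ThreeZone.system ThreeZone.virtualCenters w 0)
        (ThreeZone.annulusOrbit ThreeZone.virtualCenters h)) ∧
    -- at least three limit cycles bifurcate from it under a suitable perturbation
    ∃ (w : ThreeZone.Zone → ThreeZone.PertCoeffs) (h : Fin 3 → ℝ) (ε₀ : ℝ)
      (Γ : Fin 3 → ℝ → Set (ℝ × ℝ)),
      StrictMono h ∧ (∀ i, 0 < h i) ∧ 0 < ε₀ ∧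
      (∀ ε ∈ Ioo 0 ε₀,
        Function.Injective (fun i => Γ i ε) ∧
        ∀ i, ThreeZone.IsLimitCycle (ThreeZone.system ThreeZone.virtualCenters w ε) (Γ i ε) ∧
          ∀ z : ThreeZone.Zone, (Γ i ε ∩ z.region).Nonempty) ∧
      ∀ i, Tendsto
        (fun ε => Metric.hausdorffEDist (Γ i ε)
          (ThreeZone.annulusOrbit ThreeZone.virtualCenters (h i)))
        (𝓝[>] 0) (𝓝 0) := by
  open ThreeZone in
  refine ⟨⟨⟨(3, -2), isCenterAt_of_eq ?_ ?_ ?_, ?_⟩, ⟨(0, 0), isCenterAt_of_eq ?_ ?_ ?_, ?_⟩,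
    ⟨(0, 0), isCenterAt_of_eq ?_ ?_ ?_, ?_⟩⟩, fun w h hh => ?_, ?_⟩
  iterate 3
    · norm_num [virtualCenters, normalForm]
    · norm_num [virtualCenters, normalForm]
    · norm_num [virtualCenters, normalForm]
    · norm_num [Zone.region]
  · rw [system_zero, ← cycle_zero_eq hh]
    exact isPeriodicOrbit_cycle (cycleData_zero hh)
  obtain ⟨κ, h, hmono, hpos, hzero⟩ := exists_three_simple_zeros
  choose y₀ y₁ hy₀ hy₁ hy using fun i => exists_branch (hpos i) (hzero i).1 (hzero i).2
  have hdata := fun i =>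
    eventually_cycleData (hpos i) (hy₀ i) (hy₁ i) ((hy i).mono fun ε hε => hε.1)
  have hsep : ∀ᶠ ε in 𝓝[>] (0 : ℝ), ∀ i j, i < j → y₀ i ε < y₀ j ε := by
    refine eventually_all.2 fun i => eventually_all.2 fun j => ?_
    by_cases hij : i < j
    · filter_upwards [(hy₀ i).eventually_lt (hy₀ j) (hmono hij)] with ε hε _ using hε
    · exact Eventually.of_forall fun ε h => absurd h hij
  have hall := (eventually_all.2 hy).and ((eventually_all.2 hdata).and hsep)
  obtain ⟨ε₀, hε₀, hsub⟩ := mem_nhdsGT_iff_exists_Ioo_subset.1 hall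
  refine ⟨pert (-21 / 20) 1 κ, h, ε₀,
    fun i ε => cycle (ε * (-21 / 20)) (ε * 1) (ε * κ) (y₀ i ε) (y₁ i ε),
    hmono, hpos, hε₀, fun ε hε => ?_, fun i => ?_⟩
  · obtain ⟨hrel, hD, hlt⟩ := hsub hε
    refine ⟨fun i j hij => ?_, fun i => ⟨?_, cycle_inter_region (hD i)⟩⟩
    · -- the rising crossing of the orbit `j` is the one of the orbit `i`
      have hmem := up_mem_cycle (ε * (-21 / 20)) (ε * 1) (ε * κ) (y₀ j ε) (y₁ j ε)
      simp only at hij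
      rw [← hij] at hmem
      have hinj : StrictMono fun i => y₀ i ε := fun i j => hlt i j
      rcases cycle_crossing (hD i) hmem rfl with h1 | h1
      · exact hinj.injective (congrArg Prod.snd h1).symm
      · have := congrArg Prod.snd h1
        simp only at this
        linarith [(hD i).pos₁, (hD j).pos₀]
    · rw [system_pert]
      have hε' := hε.1
      exact isLimitCycle_cycle (hD i) (mul_ne_zero hε'.ne' (by norm_num)) (by linarith)
        (hrel i).2
  · have hlim : ∀ c : ℝ, Tendsto (fun ε : ℝ => ε * c) (𝓝[>] 0) (𝓝 0) := fun c => by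
      have hc : Continuous fun ε : ℝ => ε * c := by fun_prop
      simpa using (hc.tendsto 0).mono_left nhdsWithin_le_nhds
    rw [← cycle_zero_eq (hpos i)]
    exact tendsto_hausdorffEDist_cycle (hpos i) (hlim _) (hlim _) (hlim _) (hy₀ i) (hy₁ i)
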